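/- Consider the system $x_{t+1}=f(x_t,u_t)$, $y_t=h(x_t)$ with $x_t\in\mathbb R^n$, $u_t\in\mathbb R^m$, $y_t\in\mathbb R^p$, where $f,h$ are continuous, $f(0,0)=0$ and $h(0)=0$. Assume that: (i) the system admits a Koopman linear embedding (KLE): there are $\eta\in\mathbb N$, matrices $A,B,C$ and a map $\Psi=(\psi_1,\dots,\psi_\eta)^\top:\mathbb R^n\to\mathbb R^\eta$ with linearly independent components such that $\Psi(x_{t+1})=A\Psi(x_t)+Bu_t$ and $y_t=C\Psi(x_t)$ along all trajectories; (ii) the system is stabilizable (for every $x_0$ there is an input sequence with $x_t\to0$) and detectable (along every trajectory, $y_t\to0$ implies $x_t\to0$). Let $Q,R\succ0$ and consider the cost $J=\sum_{t}\,(y_t^\top Qy_t+u_t^\top Ru_t)\in[0,\infty]$. Then the system has a KLE with $(A,C)$ observable. Fix any such KLE, let $\ell$ be its lag (the least $k$ for which the matrix with block rows $C,CA,\dots,CA^{k-1}$ has rank $\eta$), let $\Gamma\in\mathbb R^{\eta\times p\ell}$, and for $t\ge\ell$ let $z_t=\begin{bmatrix}u_{[t-\ell,t-1]}\\ \Gamma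 y_{[t-\ell,t-1]}\end{bmatrix}\in\mathbb R^{m\ell+\eta}$, where $w_{[a,b]}$ is the column obtained by stacking $w_a,\dots,w_b$. Assume that (iii) there is a matrix $T$ of full row rank with $\xi_t=Tz_t$ for all $t\ge\ell$ along every trajectory of $\xi_{t+1}=A\xi_t+Bu_t$, $y_t=C\xi_t$. Then: 1. There is a unique $P\succ0$ with $C^\top QC+A^\top PA-P-A^\top PB(R+B^\top PB)^{-1}B^\top PA=0$. Put $K^*=(R+B^\top PB)^{-1}B^\top PA$ and $\bar K^*=K^*T$. The dynamic output feedback $u_t=-\bar K^*z_t$, $t\ge\ell$, stabilizes the nonlinear system ($x_t\to0$ for all $x_0$ and all $u_0,\dots,u_{\ell-1}$), and it minimizes the cost: its cost from time $\ell$ on is finite and at most the cost of every input sequence applied to the nonlinear system from the same state $x_\ell$. 2. Let $\{u^j_t,y^j_t\}_{t=0}^{\ell}$, $j=1,\dots,\nu$, be input-output trajectories of the nonlinear system such that the matrix with columns $(u^j_{[0,\ell]},y^j_{[0,\ell-1]})$ has rank $m(\ell+1)+\eta$. Let $\Gamma$ be obtained from them as follows: the matrix with columns $(u^j_{[0,\ell-1]},y^j_{[0,\ell-1]})$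 equals $\begin{bmatrix}I&0\\0&\Pi\end{bmatrix}\begin{bmatrix}M\\N\end{bmatrix}$, where $\Pi$ is a permutation matrix, $M$ has $m\ell+\eta$ rows and full row rank, and $\Pi^{-1}=\begin{bmatrix}\Gamma\\G\end{bmatrix}$. Then there are matrices $\bar A,\bar B,\bar C$ with $z_{t+1}=\bar Az_t+\bar Bu_t$ and $y_t=\bar Cz_t$ for all $t\ge\ell$ along every trajectory of $\xi_{t+1}=A\xi_t+Bu_t$, $y_t=C\xi_t$. Take any such matrices. Let $\mu=m(\ell+1)+\eta$, let $k_1,\dots,k_\mu$ be indices for which the $\mu\times\mu$ matrix $Z$ with columns $(z_\ell^{k_j},u_\ell^{k_j})$ is nonsingular, let $W$ be the matrix with columns $(y_\ell^{k_j},u_\ell^{k_j})$, and let $K^0$ be any matrix with $\bar A-\bar BK^0$ Schur (all eigenvalues in the open unit disc). For $i=0,1,2,\dots$ let $\Sigma_i$ be the matrix with columns $(z_{\ell+1}^{k_j},-K^iz_{\ell+1}^{k_j})$, let $\Theta^{i+1}$ solve $$Z^\top\Theta^{i+1}Z=W^\top\begin{bmatrix}Q&0\\0&R\end{bmatrix}W+\Sigma_i^\top\Theta^{i+1}\Sigma_i,$$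 and put $K^{i+1}=(\Theta^{i+1}_{uu})^{-1}\Theta^{i+1}_{uz}$, where $\Theta^{i+1}=\begin{bmatrix}\Theta^{i+1}_{zz}&(\Theta^{i+1}_{uz})^\top\\ \Theta^{i+1}_{uz}&\Theta^{i+1}_{uu}\end{bmatrix}$ is partitioned according to $(z,u)$. Then for every $i\ge0$ the equation has a unique solution $\Theta^{i+1}$ among all real $\mu\times\mu$ matrices, this solution is symmetric and $\Theta^{i+1}_{uu}$ is invertible, and $K^i$ is stabilizing: $\bar A-\bar BK^i$ is Schur, and $x_t\to0$ along every trajectory of the nonlinear system with $u_t=-K^iz_t$ for $t\ge\ell$. Moreover $K^i\to\bar K^*$ quadratically: there is a constant $c$ with $\|K^{i+1}-\bar K^*\|\le c\,\|K^i-\bar K^*\|^2$ for all $i$. -/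

import Mathlib

open Filter Topology
open scoped Matrix ENNReal

namespace KoopmanQL

noncomputable section

/-- Real column vectors with `k` entries. -/
abbrev Vec (k : ℕ) : Type := Fin k → ℝ

/-! ### The nonlinear system -/

/-- `(x, u, y)` is a trajectory of `x_{t+1} = f(x_t, u_t)`, `y_t = h(x_t)`, `t = 0, 1, 2, …`. -/
def IsTrajectory {n m p : ℕ} (f : Vec n → Vec m → Vec n) (h : Vec n → Vec p)
    (x : ℕ → Vec n) (u : ℕ → Vec m) (y : ℕ → Vec p) : Prop :=
  (∀ t, x (t + 1) = f (x t) (u t)) ∧ ∀ t, y t = h (x t)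

/-- From every initial state some input sequence drives the state to the origin. -/
def Stabilizable {n m : ℕ} (f : Vec n → Vec m → Vec n) : Prop :=
  ∀ x₀ : Vec n, ∃ (x : ℕ → Vec n) (u : ℕ → Vec m),
    x 0 = x₀ ∧ (∀ t, x (t + 1) = f (x t) (u t)) ∧ Tendsto x atTop (𝓝 0)

/-- Along every trajectory, `y_t → 0` implies `x_t → 0`. -/
def Detectable {n m p : ℕ} (f : Vec n → Vec m → Vec n) (h : Vec n → Vec p) : Prop :=
  ∀ (x : ℕ → Vec n) (u : ℕ → Vec m) (y : ℕ → Vec p), IsTrajectory f h x u y →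
    Tendsto y atTop (𝓝 0) → Tendsto x atTop (𝓝 0)

/-- The cost `∑_{t ≥ 0} y_tᵀ Q y_t + u_tᵀ R u_t`, with values in `[0, ∞]`; it is used for positive
definite weights only, so that no summand is truncated. -/
def cost {m p : ℕ} (Q : Matrix (Fin p) (Fin p) ℝ) (R : Matrix (Fin m) (Fin m) ℝ)
    (y : ℕ → Vec p) (u : ℕ → Vec m) : ℝ≥0∞ :=
  ∑' t, ENNReal.ofReal (y t ⬝ᵥ (Q *ᵥ y t) + u t ⬝ᵥ (R *ᵥ u t))

/-! ### Koopman linear embeddings -/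

/-- `(Ψ, A, B, C)` is a Koopman linear embedding of dimension `η`. Since every pair `(x, u)` is the
initial pair of some trajectory, the identities along all trajectories are pointwise identities. -/
def IsKLE {n m p η : ℕ} (f : Vec n → Vec m → Vec n) (h : Vec n → Vec p)
    (Ψ : Vec n → Vec η) (A : Matrix (Fin η) (Fin η) ℝ) (B : Matrix (Fin η) (Fin m) ℝ)
    (C : Matrix (Fin p) (Fin η) ℝ) : Prop :=
  LinearIndependent ℝ (fun (i : Fin η) (x : Vec n) => Ψ x i) ∧
  (∀ x u, Ψ (f x u) = A *ᵥ Ψ x + B *ᵥ u) ∧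
  ∀ x, h x = C *ᵥ Ψ x

/-- The system admits a Koopman linear embedding. -/
def AdmitsKLE {n m p : ℕ} (f : Vec n → Vec m → Vec n) (h : Vec n → Vec p) : Prop :=
  ∃ (η : ℕ) (Ψ : Vec n → Vec η) (A : Matrix (Fin η) (Fin η) ℝ) (B : Matrix (Fin η) (Fin m) ℝ)
    (C : Matrix (Fin p) (Fin η) ℝ), IsKLE f h Ψ A B C

/-- `(ξ, u, y)` is a trajectory of `ξ_{t+1} = A ξ_t + B u_t`, `y_t = C ξ_t`; the initial state `ξ_0`
is arbitrary. -/
def IsLinTrajectory {m p η : ℕ} (A : Matrix (Fin η) (Fin η) ℝ) (B : Matrix (Fin η) (Fin m) ℝ)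
    (C : Matrix (Fin p) (Fin η) ℝ) (ξ : ℕ → Vec η) (u : ℕ → Vec m) (y : ℕ → Vec p) : Prop :=
  (∀ t, ξ (t + 1) = A *ᵥ ξ t + B *ᵥ u t) ∧ ∀ t, y t = C *ᵥ ξ t

/-- The `k`-step observability matrix, with block rows `C, C A, …, C A ^ (k - 1)`. -/
def obsMatrix {p η : ℕ} (A : Matrix (Fin η) (Fin η) ℝ) (C : Matrix (Fin p) (Fin η) ℝ) (k : ℕ) :
    Matrix (Fin k × Fin p) (Fin η) ℝ :=
  Matrix.of fun r c => (C * A ^ (r.1 : ℕ)) r.2 c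

/-- Observability of the pair `(A, C)`. -/
def Observable {p η : ℕ} (A : Matrix (Fin η) (Fin η) ℝ) (C : Matrix (Fin p) (Fin η) ℝ) : Prop :=
  (obsMatrix A C η).rank = η

/-- `ℓ` is the lag (observability index) of the observable pair `(A, C)`. -/
def IsLag {p η : ℕ} (A : Matrix (Fin η) (Fin η) ℝ) (C : Matrix (Fin p) (Fin η) ℝ) (ℓ : ℕ) : Prop :=
  IsLeast {k : ℕ | (obsMatrix A C k).rank = η} ℓ

/-! ### The optimal gain -/

/-- `P ≻ 0` solves the algebraic Riccati equation with state weight `Cᵀ Q C`. -/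
def IsRiccatiSolution {m p η : ℕ} (A : Matrix (Fin η) (Fin η) ℝ) (B : Matrix (Fin η) (Fin m) ℝ)
    (C : Matrix (Fin p) (Fin η) ℝ) (Q : Matrix (Fin p) (Fin p) ℝ) (R : Matrix (Fin m) (Fin m) ℝ)
    (P : Matrix (Fin η) (Fin η) ℝ) : Prop :=
  P.PosDef ∧
  Cᵀ * Q * C + Aᵀ * P * A - P - Aᵀ * P * B * (R + Bᵀ * P * B)⁻¹ * Bᵀ * P * A = 0

/-- `K* = (R + Bᵀ P B)⁻¹ Bᵀ P A`. -/
def lqrGain {m η : ℕ} (A : Matrix (Fin η) (Fin η) ℝ) (B : Matrix (Fin η) (Fin m) ℝ)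
    (R : Matrix (Fin m) (Fin m) ℝ) (P : Matrix (Fin η) (Fin η) ℝ) : Matrix (Fin m) (Fin η) ℝ :=
  (R + Bᵀ * P * B)⁻¹ * Bᵀ * P * A

/-! ### The nonminimal input-output state -/

/-- Index set of the `m ℓ + η` entries of the nonminimal state. -/
abbrev ZIdx (m ℓ η : ℕ) : Type := (Fin ℓ × Fin m) ⊕ Fin η

/-- `window w s k` stacks `w_s, …, w_{s + k - 1}`. -/
def window {d : ℕ} (w : ℕ → Vec d) (s k : ℕ) : Fin k × Fin d → ℝ :=
  fun r => w (s + r.1) r.2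

/-- `zState Γ u y s` is the nonminimal state at time `s + ℓ`, that is
`z_{s + ℓ} = (u_{[s, s + ℓ - 1]}, Γ y_{[s, s + ℓ - 1]})`. -/
def zState {m p ℓ η : ℕ} (Γ : Matrix (Fin η) (Fin ℓ × Fin p) ℝ)
    (u : ℕ → Vec m) (y : ℕ → Vec p) (s : ℕ) : ZIdx m ℓ η → ℝ :=
  Sum.elim (window u s ℓ) (Γ *ᵥ window y s ℓ)

/-- `T` has full row rank, and `ξ_t = T z_t` for all `t ≥ ℓ` along every trajectory of the linear
system `(A, B, C)`. -/
def IsStateMap {m p ℓ η : ℕ} (A : Matrix (Fin η) (Fin η) ℝ) (B : Matrix (Fin η) (Fin m) ℝ)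
    (C : Matrix (Fin p) (Fin η) ℝ) (Γ : Matrix (Fin η) (Fin ℓ × Fin p) ℝ)
    (T : Matrix (Fin η) (ZIdx m ℓ η) ℝ) : Prop :=
  T.rank = η ∧
  ∀ (ξ : ℕ → Vec η) (u : ℕ → Vec m) (y : ℕ → Vec p), IsLinTrajectory A B C ξ u y →
    ∀ s, ξ (s + ℓ) = T *ᵥ zState Γ u y s

/-- `(Ab, Bb, Cb)` realizes the linear system in the state `z`: `z_{t+1} = Ab z_t + Bb u_t` and
`y_t = Cb z_t` for all `t ≥ ℓ` along every trajectory of `(A, B, C)`. -/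
def IsZRealization {m p ℓ η : ℕ} (A : Matrix (Fin η) (Fin η) ℝ) (B : Matrix (Fin η) (Fin m) ℝ)
    (C : Matrix (Fin p) (Fin η) ℝ) (Γ : Matrix (Fin η) (Fin ℓ × Fin p) ℝ)
    (Ab : Matrix (ZIdx m ℓ η) (ZIdx m ℓ η) ℝ) (Bb : Matrix (ZIdx m ℓ η) (Fin m) ℝ)
    (Cb : Matrix (Fin p) (ZIdx m ℓ η) ℝ) : Prop :=
  ∀ (ξ : ℕ → Vec η) (u : ℕ → Vec m) (y : ℕ → Vec p), IsLinTrajectory A B C ξ u y →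
    ∀ s, zState Γ u y (s + 1) = Ab *ᵥ zState Γ u y s + Bb *ᵥ u (s + ℓ) ∧
      y (s + ℓ) = Cb *ᵥ zState Γ u y s

/-- `(x, u, y)` is a trajectory of the nonlinear system in which the feedback `u_t = -K z_t` acts
from the first time `t = ℓ` at which `z_t` is available; `x_0` and `u_0, …, u_{ℓ - 1}` are
arbitrary. -/
def IsClosedLoop {n m p ℓ η : ℕ} (f : Vec n → Vec m → Vec n) (h : Vec n → Vec p)
    (Γ : Matrix (Fin η) (Fin ℓ × Fin p) ℝ) (K : Matrix (Fin m) (ZIdx m ℓ η) ℝ)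
    (x : ℕ → Vec n) (u : ℕ → Vec m) (y : ℕ → Vec p) : Prop :=
  IsTrajectory f h x u y ∧ ∀ s, u (s + ℓ) = -(K *ᵥ zState Γ u y s)

/-- The feedback `u_t = -K z_t` stabilizes the nonlinear system: `x_t → 0` in closed loop. -/
def Stabilizes {n m p ℓ η : ℕ} (f : Vec n → Vec m → Vec n) (h : Vec n → Vec p)
    (Γ : Matrix (Fin η) (Fin ℓ × Fin p) ℝ) (K : Matrix (Fin m) (ZIdx m ℓ η) ℝ) : Prop :=
  ∀ (x : ℕ → Vec n) (u : ℕ → Vec m) (y : ℕ → Vec p), IsClosedLoop f h Γ K x u y →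
    Tendsto x atTop (𝓝 0)

/-- The feedback `u_t = -K z_t` minimizes the cost: from the time `ℓ` at which it is switched on,
its cost is finite and at most the cost of any trajectory of the nonlinear system that starts at
the same state `x_ℓ`, whatever its input sequence. -/
def MinimizesCost {n m p ℓ η : ℕ} (f : Vec n → Vec m → Vec n) (h : Vec n → Vec p)
    (Q : Matrix (Fin p) (Fin p) ℝ) (R : Matrix (Fin m) (Fin m) ℝ)
    (Γ : Matrix (Fin η) (Fin ℓ × Fin p) ℝ) (K : Matrix (Fin m) (ZIdx m ℓ η) ℝ) : Prop :=
  ∀ (x : ℕ → Vec n) (u : ℕ → Vec m) (y : ℕ → Vec p), IsClosedLoop f h Γ K x u y →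
    cost Q R (fun t => y (t + ℓ)) (fun t => u (t + ℓ)) < ⊤ ∧
    ∀ (x' : ℕ → Vec n) (u' : ℕ → Vec m) (y' : ℕ → Vec p), IsTrajectory f h x' u' y' →
      x' 0 = x ℓ →
      cost Q R (fun t => y (t + ℓ)) (fun t => u (t + ℓ)) ≤ cost Q R y' u'

/-! ### Data and the construction of `Γ` -/

/-- `{u_t, y_t}`, `t = 0, …, ℓ`, is an input-output trajectory of length `ℓ + 1` of the nonlinear
system; the values at later times are irrelevant. -/
def IsDataTrajectory {n m p : ℕ} (f : Vec n → Vec m → Vec n) (h : Vec n → Vec p) (ℓ : ℕ)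
    (u : ℕ → Vec m) (y : ℕ → Vec p) : Prop :=
  ∃ x : ℕ → Vec n, (∀ t < ℓ, x (t + 1) = f (x t) (u t)) ∧ ∀ t ≤ ℓ, y t = h (x t)

/-- The matrix whose `j`-th column stacks `w^j_0, …, w^j_{k - 1}`. -/
def windowMatrix {d ν : ℕ} (w : Fin ν → ℕ → Vec d) (k : ℕ) :
    Matrix (Fin k × Fin d) (Fin ν) ℝ :=
  Matrix.of fun r j => window (w j) 0 k r

/-- The data are persistently excited of order `η + ℓ + 1`: the matrix with block rows
`u_{[0, ℓ]}` and `y_{[0, ℓ - 1]}` has rank `m (ℓ + 1) + η`. -/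
def PersistentlyExcited {m p ν : ℕ} (ℓ η : ℕ) (ud : Fin ν → ℕ → Vec m)
    (yd : Fin ν → ℕ → Vec p) : Prop :=
  (Matrix.fromRows (windowMatrix ud (ℓ + 1)) (windowMatrix yd ℓ)).rank = m * (ℓ + 1) + η

/-- `Γ` is a possible output of the data-driven construction: the matrix with block rows
`u_{[0, ℓ - 1]}` and `y_{[0, ℓ - 1]}` equals `diag(I, Pm) [M; N]`, where `Pm` is a permutation
matrix and `M` has full row rank `m ℓ + η`, and `Pm⁻¹ = [Γ; G]`. -/
def IsGammaFromData {m p ℓ η ν : ℕ} (ud : Fin ν → ℕ → Vec m) (yd : Fin ν → ℕ → Vec p)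
    (Γ : Matrix (Fin η) (Fin ℓ × Fin p) ℝ) : Prop :=
  ∃ (r : ℕ) (e : (Fin η ⊕ Fin r) ≃ (Fin ℓ × Fin p))
    (Pm : Matrix (Fin ℓ × Fin p) (Fin η ⊕ Fin r) ℝ)
    (M : Matrix (ZIdx m ℓ η) (Fin ν) ℝ) (N : Matrix (Fin r) (Fin ν) ℝ)
    (G : Matrix (Fin r) (Fin ℓ × Fin p) ℝ),
    (Pm = Matrix.of fun b a => if b = e a then 1 else 0) ∧
    Matrix.fromRows (windowMatrix ud ℓ) (windowMatrix yd ℓ) =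
      Matrix.fromBlocks (1 : Matrix (Fin ℓ × Fin m) (Fin ℓ × Fin m) ℝ) 0 0 Pm *
        (Matrix.fromRows M N).submatrix (Equiv.sumAssoc (Fin ℓ × Fin m) (Fin η) (Fin r)).symm id ∧
    M.rank = m * ℓ + η ∧
    Pm * Matrix.fromRows Γ G = 1 ∧ Matrix.fromRows Γ G * Pm = 1

/-! ### Output-feedback Q-learning -/

/-- Index set of the `μ = m (ℓ + 1) + η` rows of the data matrix `Z`; it also serves to label the
`μ` selected trajectories. -/
abbrev ThIdx (m ℓ η : ℕ) : Type := ZIdx m ℓ η ⊕ Fin m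

/-- The square matrix `Z` with columns `(z_ℓ^{k_j}, u_ℓ^{k_j})`. -/
def Zmat {m p ℓ η ν : ℕ} (Γ : Matrix (Fin η) (Fin ℓ × Fin p) ℝ) (ud : Fin ν → ℕ → Vec m)
    (yd : Fin ν → ℕ → Vec p) (k : ThIdx m ℓ η → Fin ν) :
    Matrix (ThIdx m ℓ η) (ThIdx m ℓ η) ℝ :=
  Matrix.of fun r j => Sum.elim (zState Γ (ud (k j)) (yd (k j)) 0) (ud (k j) ℓ) r

/-- The matrix `W` with columns `(y_ℓ^{k_j}, u_ℓ^{k_j})`. -/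
def Wmat {m p ℓ η ν : ℕ} (ud : Fin ν → ℕ → Vec m)
    (yd : Fin ν → ℕ → Vec p) (k : ThIdx m ℓ η → Fin ν) :
    Matrix (Fin p ⊕ Fin m) (ThIdx m ℓ η) ℝ :=
  Matrix.of fun r j => Sum.elim (yd (k j) ℓ) (ud (k j) ℓ) r

/-- The matrix `Σ` of the gain `K`, with columns `(z_{ℓ+1}^{k_j}, -K z_{ℓ+1}^{k_j})`. -/
def Smat {m p ℓ η ν : ℕ} (Γ : Matrix (Fin η) (Fin ℓ × Fin p) ℝ) (ud : Fin ν → ℕ → Vec m)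
    (yd : Fin ν → ℕ → Vec p) (k : ThIdx m ℓ η → Fin ν) (K : Matrix (Fin m) (ZIdx m ℓ η) ℝ) :
    Matrix (ThIdx m ℓ η) (ThIdx m ℓ η) ℝ :=
  Matrix.of fun r j => Sum.elim (zState Γ (ud (k j)) (yd (k j)) 1)
    (-(K *ᵥ zState Γ (ud (k j)) (yd (k j)) 1)) r

/-- The data-based Bellman equation `Zᵀ Θ Z = Wᵀ diag(Q, R) W + Σᵀ Θ Σ` of the gain `K`. -/
def Bellman {m p ℓ η ν : ℕ} (Q : Matrix (Fin p) (Fin p) ℝ) (R : Matrix (Fin m) (Fin m) ℝ)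
    (Γ : Matrix (Fin η) (Fin ℓ × Fin p) ℝ) (ud : Fin ν → ℕ → Vec m)
    (yd : Fin ν → ℕ → Vec p) (k : ThIdx m ℓ η → Fin ν) (K : Matrix (Fin m) (ZIdx m ℓ η) ℝ)
    (Θ : Matrix (ThIdx m ℓ η) (ThIdx m ℓ η) ℝ) : Prop :=
  (Zmat Γ ud yd k)ᵀ * Θ * Zmat Γ ud yd k =
    (Wmat ud yd k)ᵀ * Matrix.fromBlocks Q 0 0 R * Wmat ud yd k +
      (Smat Γ ud yd k K)ᵀ * Θ * Smat Γ ud yd k K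

/-- All complex eigenvalues of the real square matrix `M` lie in the open unit disc. -/
def IsSchur {ι : Type} [Fintype ι] [DecidableEq ι] (M : Matrix ι ι ℝ) : Prop :=
  ∀ c ∈ spectrum ℂ (M.map (algebraMap ℝ ℂ)), ‖c‖ < 1

/-- The Frobenius norm. -/
def frobNorm {ι κ : Type} [Fintype ι] [Fintype κ] (M : Matrix ι κ ℝ) : ℝ :=
  Real.sqrt (∑ i, ∑ j, M i j ^ 2)

/-- `K^i → L` with a quadratic rate. -/
def ConvergesQuadratically {ι κ : Type} [Fintype ι] [Fintype κ] (K : ℕ → Matrix ι κ ℝ)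
    (L : Matrix ι κ ℝ) : Prop :=
  Tendsto K atTop (𝓝 L) ∧
  ∃ c : ℝ, ∀ i, frobNorm (K (i + 1) - L) ≤ c * frobNorm (K i - L) ^ 2

end

end KoopmanQL

open KoopmanQL

/-! The embedding turns the nonlinear problem into a linear-quadratic one. Along a trajectory, `Ψ (x
t)` is a trajectory of the linear system with the same inputs and outputs, so costs agree.
Observability makes `Ψ` a linear image of finitely many zero-input outputs, hence continuous, with
`Ψ 0 = 0`. An input steering `x` to the origin therefore steers `Ψ x` to the origin. The steerable
states form a subspace containing the range of `Ψ`, which spans because the observables are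
independent. So every linear state is steerable, even those that are not of the form `Ψ x`.

Steerability gives finite cost, value iteration then converges to a Riccati solution
(`exists_riccati`), and observability makes it definite. The map `ξ = T z` supplies detectability:
if inputs and outputs vanish in the limit, so does the window `z`, hence `ξ`. Completing the square
(`stage_add_qf_next`) and telescoping bound the cost of every linear trajectory from below by `P`,
and the feedback attains the bound. Nonlinear competitors are among these linear trajectories.

For the learning part, the data make `z` range over its whole space, so `T` intertwines the
nonminimal realization with the minimal one and `Tᵀ P T` solves the nonminimal Riccati equation.
That matrix is in general singular. For this reason the linear-quadratic theory below uses
semidefinite value matrices and replaces definiteness by `StageDetectable`. Nonsingularity of `Z`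
turns the Bellman equation into a Stein equation for the closed-loop pair `(z, u)` (`bellman_iff`).
Its unique solution is the state-action value matrix of the current gain, so the algorithm is
Hewer's policy iteration (`StageDetectable.policy_iteration`). The rate is quadratic because the
value error is quadratic in the gain error, and the next gain error is bounded by a multiple of the
value error. -/

set_option linter.unusedSectionVars false

namespace KoopmanQL

/-! ### Quadratic forms and limits of symmetric matrices -/

section Forms

variable {ι κ : Type} [Fintype ι] [Fintype κ]

/-- The quadratic form `z ↦ zᵀ X z`. -/
def qf (X : Matrix ι ι ℝ) (z : ι → ℝ) : ℝ := z ⬝ᵥ (X *ᵥ z)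

lemma qf_add (X Y : Matrix ι ι ℝ) (z : ι → ℝ) : qf (X + Y) z = qf X z + qf Y z := by
  simp [qf, Matrix.add_mulVec]

lemma qf_sub (X Y : Matrix ι ι ℝ) (z : ι → ℝ) : qf (X - Y) z = qf X z - qf Y z := by
  simp [qf, Matrix.sub_mulVec]

lemma qf_conj (X : Matrix κ κ ℝ) (F : Matrix κ ι ℝ) (z : ι → ℝ) :
    qf (Fᵀ * X * F) z = qf X (F *ᵥ z) := by
  simp only [qf, ← Matrix.mulVec_mulVec]
  rw [Matrix.dotProduct_mulVec, Matrix.vecMul_transpose]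

lemma qf_zero_right (X : Matrix ι ι ℝ) : qf X 0 = 0 := by simp [qf]

lemma qf_zero_left (z : ι → ℝ) : qf 0 z = 0 := by simp [qf]

lemma qf_neg_right (X : Matrix ι ι ℝ) (z : ι → ℝ) : qf X (-z) = qf X z := by
  simp [qf, Matrix.mulVec_neg]

lemma dotProduct_symm {X : Matrix ι ι ℝ} (hX : X.IsSymm) (a b : ι → ℝ) :
    a ⬝ᵥ (X *ᵥ b) = b ⬝ᵥ (X *ᵥ a) := by
  rw [Matrix.dotProduct_mulVec, dotProduct_comm, ← Matrix.mulVec_transpose, hX.eq]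

lemma qf_add_right {X : Matrix ι ι ℝ} (hX : X.IsSymm) (a b : ι → ℝ) :
    qf X (a + b) = qf X a + 2 * (b ⬝ᵥ (X *ᵥ a)) + qf X b := by
  simp only [qf, Matrix.mulVec_add, add_dotProduct, dotProduct_add]
  rw [dotProduct_symm hX a b]; ring

lemma continuous_qf (X : Matrix ι ι ℝ) : Continuous (qf X) := by
  unfold qf; fun_prop

lemma continuous_qf_left (z : ι → ℝ) : Continuous fun X : Matrix ι ι ℝ => qf X z := by
  unfold qf; fun_prop

lemma posSemidef_iff_qf {X : Matrix ι ι ℝ} : X.PosSemidef ↔ X.IsSymm ∧ ∀ z, 0 ≤ qf X z := by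
  rw [Matrix.posSemidef_iff_dotProduct_mulVec]
  simp [Matrix.IsHermitian, Matrix.IsSymm, qf]

lemma _root_.Matrix.PosSemidef.qf_nonneg {X : Matrix ι ι ℝ} (hX : X.PosSemidef) (z : ι → ℝ) :
    0 ≤ qf X z := (posSemidef_iff_qf.1 hX).2 z

lemma _root_.Matrix.PosSemidef.isSymm {X : Matrix ι ι ℝ} (hX : X.PosSemidef) : X.IsSymm :=
  (posSemidef_iff_qf.1 hX).1

lemma posDef_iff_qf {X : Matrix ι ι ℝ} : X.PosDef ↔ X.IsSymm ∧ ∀ z, z ≠ 0 → 0 < qf X z := by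
  rw [Matrix.posDef_iff_dotProduct_mulVec]
  simp [Matrix.IsHermitian, Matrix.IsSymm, qf]

lemma isSymm_conj {X : Matrix κ κ ℝ} (hX : X.IsSymm) (F : Matrix κ ι ℝ) :
    (Fᵀ * X * F).IsSymm := by
  simp [Matrix.IsSymm, Matrix.transpose_mul, hX.eq, Matrix.mul_assoc]

lemma posSemidef_conj {X : Matrix κ κ ℝ} (hX : X.PosSemidef) (F : Matrix κ ι ℝ) :
    (Fᵀ * X * F).PosSemidef :=
  posSemidef_iff_qf.2 ⟨isSymm_conj hX.isSymm F, fun z => by rw [qf_conj]; exact hX.qf_nonneg _⟩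

variable [DecidableEq ι]

/-- Polarization; it reduces equality and convergence of symmetric matrices to their quadratic
forms. -/
lemma entry_eq_qf {X : Matrix ι ι ℝ} (hX : X.IsSymm) (i j : ι) :
    X i j = (qf X (Pi.single i 1 + Pi.single j 1) - qf X (Pi.single i 1)
      - qf X (Pi.single j 1)) / 2 := by
  rw [qf_add_right hX]
  have : X i j = X j i := (hX.apply i j).symm
  simp [this]
  ring

lemma eq_of_qf_eq {X Y : Matrix ι ι ℝ} (hX : X.IsSymm) (hY : Y.IsSymm)
    (hXY : ∀ z, qf X z = qf Y z) : X = Y := by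
  ext i j
  rw [entry_eq_qf hX, entry_eq_qf hY, hXY, hXY, hXY]

lemma tendsto_matrix_iff {α : Type} {l : Filter α} {X : α → Matrix ι κ ℝ} {Y : Matrix ι κ ℝ} :
    Tendsto X l (𝓝 Y) ↔ ∀ i j, Tendsto (fun a => X a i j) l (𝓝 (Y i j)) := by
  refine ⟨fun h i j => ?_, fun h => ?_⟩
  · exact tendsto_pi_nhds.1 (tendsto_pi_nhds.1 h i) j
  · exact tendsto_pi_nhds.2 fun i => tendsto_pi_nhds.2 fun j => h i j

/-- A sequence of symmetric matrices converges as soon as all its quadratic forms do. -/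
lemma exists_tendsto_of_qf {X : ℕ → Matrix ι ι ℝ} (hX : ∀ i, (X i).IsSymm)
    (hc : ∀ z, ∃ l, Tendsto (fun i => qf (X i) z) atTop (𝓝 l)) :
    ∃ Y, Tendsto X atTop (𝓝 Y) := by
  choose q hq using hc
  refine ⟨Matrix.of fun i j => (q (Pi.single i 1 + Pi.single j 1) - q (Pi.single i 1)
      - q (Pi.single j 1)) / 2, tendsto_matrix_iff.2 fun i j => ?_⟩
  simp only [fun a => entry_eq_qf (hX a) i j]
  exact (((hq _).sub (hq _)).sub (hq _)).div_const 2

lemma isSymm_of_tendsto {X : ℕ → Matrix ι ι ℝ} {Y : Matrix ι ι ℝ} (hX : ∀ i, (X i).IsSymm)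
    (h : Tendsto X atTop (𝓝 Y)) : Y.IsSymm := by
  refine Matrix.IsSymm.ext fun i j => ?_
  refine tendsto_nhds_unique (tendsto_matrix_iff.1 h j i) ?_
  simpa only [fun a => (hX a).apply i j] using tendsto_matrix_iff.1 h i j

lemma posSemidef_of_tendsto {X : ℕ → Matrix ι ι ℝ} {Y : Matrix ι ι ℝ}
    (hX : ∀ i, (X i).PosSemidef) (h : Tendsto X atTop (𝓝 Y)) : Y.PosSemidef :=
  posSemidef_iff_qf.2 ⟨isSymm_of_tendsto (fun i => (hX i).isSymm) h, fun z =>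
    ge_of_tendsto' (((continuous_qf_left z).tendsto _).comp h) fun i => (hX i).qf_nonneg z⟩

/-- A positive definite form dominates a multiple of every squared coordinate, so a sequence
along which it vanishes tends to zero. -/
lemma tendsto_zero_of_qf {X : Matrix ι ι ℝ} (hX : X.PosDef) {z : ℕ → ι → ℝ}
    (h : Tendsto (fun t => qf X (z t)) atTop (𝓝 0)) : Tendsto z atTop (𝓝 0) := by
  obtain ⟨hs, hp⟩ := posDef_iff_qf.1 hX
  rcases isEmpty_or_nonempty ι with hι | hι
  · rw [show z = fun _ => 0 from Subsingleton.elim _ _]; exact tendsto_const_nhds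
  -- The minimum over the unit sphere is the constant of domination, by homogeneity of degree two.
  obtain ⟨v, hv, hmin⟩ := (isCompact_sphere (0 : ι → ℝ) 1).exists_isMinOn
    (NormedSpace.sphere_nonempty.2 zero_le_one) (continuous_qf X).continuousOn
  have hv0 : v ≠ 0 := by rintro rfl; simp at hv
  have hpos := hp v hv0
  have hle : ∀ w, qf X v * ‖w‖ ^ 2 ≤ qf X w := by
    intro w
    by_cases hw : w = 0
    · simp [hw, qf_zero_right]
    have hn : ‖w‖ ≠ 0 := norm_ne_zero_iff.2 hw
    have h1 : qf X v ≤ qf X (‖w‖⁻¹ • w) := hmin (show ‖w‖⁻¹ • w ∈ Metric.sphere (0 : ι → ℝ) 1 by simp [norm_smul, hn])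
    have h2 : qf X (‖w‖⁻¹ • w) = (‖w‖⁻¹) ^ 2 * qf X w := by
      simp [qf, Matrix.mulVec_smul]; ring
    rw [h2] at h1
    calc qf X v * ‖w‖ ^ 2 ≤ (‖w‖⁻¹) ^ 2 * qf X w * ‖w‖ ^ 2 := by gcongr
      _ = qf X w := by field_simp
  rw [tendsto_zero_iff_norm_tendsto_zero]
  have h3 : Tendsto (fun t => ‖z t‖ ^ 2) atTop (𝓝 0) := by
    refine squeeze_zero (fun _ => sq_nonneg _) (g := fun t => qf X (z t) / qf X v) (fun t => ?_) ?_
    · rw [le_div_iff₀ hpos, mul_comm]; exact hle _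
    · simpa using h.div_const (qf X v)
  simpa [Real.sqrt_sq, Function.comp_def] using (Real.continuous_sqrt.tendsto _).comp h3

end Forms

/-! ### Schur matrices, vanishing powers and the Stein equation -/

section Powers

variable {ι : Type} [Fintype ι] [DecidableEq ι]

/-- The powers of `F` tend to zero. -/
def PowTendsto (F : Matrix ι ι ℝ) : Prop := Tendsto (fun k : ℕ => F ^ k) atTop (𝓝 0)

lemma PowTendsto.mulVec {F : Matrix ι ι ℝ} (hF : PowTendsto F) (z : ι → ℝ) :
    Tendsto (fun k : ℕ => F ^ k *ᵥ z) atTop (𝓝 0) := by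
  have hc : Continuous fun X : Matrix ι ι ℝ => X *ᵥ z := by fun_prop
  simpa [Function.comp_def] using (hc.tendsto 0).comp hF

lemma powTendsto_of_mulVec {F : Matrix ι ι ℝ}
    (h : ∀ z, Tendsto (fun k : ℕ => F ^ k *ᵥ z) atTop (𝓝 0)) : PowTendsto F := by
  refine tendsto_matrix_iff.2 fun i j => ?_
  simpa using tendsto_pi_nhds.1 (h (Pi.single j 1)) i

lemma iterate_eq_pow_mulVec {F : Matrix ι ι ℝ} {z : ℕ → ι → ℝ} (hz : ∀ t, z (t + 1) = F *ᵥ z t)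
    (t : ℕ) : z t = F ^ t *ᵥ z 0 := by
  induction t with
  | zero => simp
  | succ t ih => rw [hz, ih, pow_succ', Matrix.mulVec_mulVec]

lemma PowTendsto.tendsto_iterate {F : Matrix ι ι ℝ} (hF : PowTendsto F) {z : ℕ → ι → ℝ}
    (hz : ∀ t, z (t + 1) = F *ᵥ z t) : Tendsto z atTop (𝓝 0) := by
  rw [show z = fun t => F ^ t *ᵥ z 0 from funext (iterate_eq_pow_mulVec hz)]
  exact hF.mulVec _

section Norm

attribute [local instance] Matrix.linftyOpNormedRing Matrix.linftyOpNormedAlgebra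

lemma norm_entry_le_linftyOp {M : Matrix ι ι ℂ} (i j : ι) : ‖M i j‖ ≤ ‖M‖ := by
  rw [← coe_nnnorm, ← coe_nnnorm, Matrix.linfty_opNNNorm_def]
  norm_cast
  calc ‖M i j‖₊ ≤ ∑ j, ‖M i j‖₊ := Finset.single_le_sum (f := fun j => ‖M i j‖₊)
        (fun _ _ => zero_le) (Finset.mem_univ j)
    _ ≤ _ := Finset.le_sup (f := fun i => ∑ j, ‖M i j‖₊) (Finset.mem_univ i)

/-- Gelfand's formula: compactness of the spectrum puts the spectral radius strictly below one, so
the norms of the complexified powers are eventually below a geometric sequence. -/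
lemma IsSchur.powTendsto {F : Matrix ι ι ℝ} (hF : IsSchur F) : PowTendsto F := by
  rcases isEmpty_or_nonempty ι with hι | hι
  · exact powTendsto_of_mulVec fun z => by
      rw [show (fun k : ℕ => F ^ k *ᵥ z) = fun _ => 0 from Subsingleton.elim _ _]
      exact tendsto_const_nhds
  set a : Matrix ι ι ℂ := F.map (algebraMap ℝ ℂ) with ha
  have : CompleteSpace (Matrix ι ι ℂ) := FiniteDimensional.complete ℂ _
  have hr : spectralRadius ℂ a < (1 : NNReal) :=
    spectrum.spectralRadius_lt_of_forall_lt a fun c hc => hF c hc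
  obtain ⟨r, hr1, hr2⟩ := exists_between hr
  have hg := spectrum.pow_nnnorm_pow_one_div_tendsto_nhds_spectralRadius a
  have hev := hg.eventually_lt_const hr1
  have hr2' : r < 1 := by simpa using hr2
  have hrt : r ≠ ⊤ := ne_top_of_lt hr2'
  have hb : ∀ᶠ k : ℕ in atTop, ‖a ^ k‖ ≤ r.toReal ^ k := by
    filter_upwards [hev, eventually_gt_atTop 0] with k hk hk0
    have h1 : (‖a ^ k‖₊ : ℝ≥0∞) ≤ r ^ k := by
      have := ENNReal.rpow_le_rpow hk.le (z := (k : ℝ)) (by positivity)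
      rw [← ENNReal.rpow_mul, one_div, inv_mul_cancel₀ (by positivity), ENNReal.rpow_one,
        ENNReal.rpow_natCast] at this
      exact this
    have h2 := ENNReal.toReal_mono (ENNReal.pow_ne_top hrt) h1
    simpa using h2
  have hz : Tendsto (fun k : ℕ => r.toReal ^ k) atTop (𝓝 0) := by
    refine tendsto_pow_atTop_nhds_zero_of_lt_one ENNReal.toReal_nonneg ?_
    simpa using ENNReal.toReal_strict_mono ENNReal.one_ne_top hr2'
  refine tendsto_matrix_iff.2 fun i j => ?_
  rw [Matrix.zero_apply, tendsto_zero_iff_norm_tendsto_zero]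
  refine squeeze_zero' (Eventually.of_forall fun _ => norm_nonneg _) ?_ hz
  filter_upwards [hb] with k hk
  refine le_trans ?_ (hk.trans' (norm_entry_le_linftyOp i j))
  have h3 : a ^ k = (F ^ k).map (algebraMap ℝ ℂ) := by
    rw [ha]; exact (map_pow (algebraMap ℝ ℂ).mapMatrix F k).symm
  simp [h3]

end Norm

/-- On an eigenvector the `k`-th power acts as `c ^ k`; reading off a nonzero coordinate gives `c ^
k → 0`. -/
lemma PowTendsto.isSchur {F : Matrix ι ι ℝ} (hF : PowTendsto F) : IsSchur F := by
  intro c hc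
  set a : Matrix ι ι ℂ := F.map (algebraMap ℝ ℂ) with ha
  rw [← Matrix.spectrum_toLin', ← Module.End.hasEigenvalue_iff_mem_spectrum] at hc
  obtain ⟨v, hv⟩ := hc.exists_hasEigenvector
  have hpow : ∀ k : ℕ, a ^ k *ᵥ v = c ^ k • v := fun k => by
    have := hv.pow_apply k
    rwa [← Matrix.toLin'_pow, Matrix.toLin'_apply] at this
  obtain ⟨i, hi⟩ := Function.ne_iff.1 hv.2
  have ht : Tendsto (fun k : ℕ => c ^ k * v i) atTop (𝓝 0) := by
    have h1 : ∀ k : ℕ, c ^ k * v i = ∑ j, ((F ^ k) i j : ℂ) * v j := fun k => by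
      have := congrFun (hpow k) i
      have h3 : a ^ k = (F ^ k).map (algebraMap ℝ ℂ) := by
        rw [ha]; exact (map_pow (algebraMap ℝ ℂ).mapMatrix F k).symm
      simp only [Pi.smul_apply, smul_eq_mul] at this
      rw [← this, h3]
      simp [Matrix.mulVec, dotProduct]
    simp only [h1]
    have h2 : Tendsto (fun k : ℕ => ∑ j, ((F ^ k) i j : ℂ) * v j) atTop
        (𝓝 (∑ j, ((0 : ℝ) : ℂ) * v j)) :=
      tendsto_finsetSum _ fun j _ => ((Complex.continuous_ofReal.tendsto _).comp
        (tendsto_matrix_iff.1 hF i j)).mul_const _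
    simpa using h2
  have ht2 : Tendsto (fun k : ℕ => c ^ k) atTop (𝓝 0) := by
    have := ht.mul_const (v i)⁻¹
    simpa [mul_assoc, mul_inv_cancel₀ hi] using this
  exact tendsto_pow_atTop_nhds_zero_iff_norm_lt_one.1 ht2

lemma transpose_pow_mul_mul_pow {F X : Matrix ι ι ℝ} (h : X = Fᵀ * X * F) (k : ℕ) :
    X = (F ^ k)ᵀ * X * F ^ k := by
  induction k with
  | zero => simp
  | succ k ih =>
    conv_lhs => rw [ih, h]
    rw [pow_succ', Matrix.transpose_mul]
    simp only [Matrix.mul_assoc]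

/-- Iterating the equation conjugates `X` by ever higher powers of `F`, which vanish. No symmetry of
`X` enters, so the Bellman equation is later uniquely solvable among all matrices. -/
lemma PowTendsto.eq_zero_of_stein {F X : Matrix ι ι ℝ} (hF : PowTendsto F)
    (h : X = Fᵀ * X * F) : X = 0 := by
  have hc : Continuous fun Y : Matrix ι ι ℝ => Yᵀ * X * Y := by fun_prop
  have h1 := (hc.tendsto 0).comp hF
  simp only [Function.comp_def, ← transpose_pow_mul_mul_pow h, Matrix.mul_zero] at h1
  exact tendsto_nhds_unique tendsto_const_nhds h1

/-- The Stein operator `X ↦ X - Fᵀ X F`. -/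
def stein (F : Matrix ι ι ℝ) : Matrix ι ι ℝ →ₗ[ℝ] Matrix ι ι ℝ where
  toFun X := X - Fᵀ * X * F
  map_add' X Y := by simp only [Matrix.mul_add, Matrix.add_mul]; abel
  map_smul' c X := by simp [smul_sub]

lemma stein_apply (F X : Matrix ι ι ℝ) : stein F X = X - Fᵀ * X * F := rfl

lemma PowTendsto.stein_injective {F : Matrix ι ι ℝ} (hF : PowTendsto F) :
    Function.Injective (stein F) := by
  rw [injective_iff_map_eq_zero]
  exact fun X hX => hF.eq_zero_of_stein (sub_eq_zero.1 hX)

/-- An injective endomorphism of a finite-dimensional space is onto. -/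
lemma PowTendsto.exists_stein {F : Matrix ι ι ℝ} (hF : PowTendsto F) (E : Matrix ι ι ℝ) :
    ∃ X, X = E + Fᵀ * X * F := by
  obtain ⟨X, hX⟩ := LinearMap.injective_iff_surjective.1 hF.stein_injective E
  exact ⟨X, by rw [← hX, stein_apply]; abel⟩

lemma PowTendsto.stein_unique {F E X Y : Matrix ι ι ℝ} (hF : PowTendsto F)
    (hX : X = E + Fᵀ * X * F) (hY : Y = E + Fᵀ * Y * F) : X = Y := by
  apply hF.stein_injective
  rw [stein_apply, stein_apply, sub_eq_of_eq_add hX, sub_eq_of_eq_add hY]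

/-- The transpose solves the same equation, so uniqueness applies. -/
lemma PowTendsto.stein_isSymm {F E X : Matrix ι ι ℝ} (hF : PowTendsto F) (hE : E.IsSymm)
    (hX : X = E + Fᵀ * X * F) : X.IsSymm := by
  refine hF.stein_unique ?_ hX
  conv_lhs => rw [hX]
  simp [Matrix.transpose_mul, hE.eq, Matrix.mul_assoc]

/-- A form that does not increase along a map with vanishing powers is nonnegative. -/
lemma PowTendsto.qf_nonneg {F D : Matrix ι ι ℝ} (hF : PowTendsto F)
    (hD : ∀ z, qf D (F *ᵥ z) ≤ qf D z) (z : ι → ℝ) : 0 ≤ qf D z := by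
  have h1 : ∀ k : ℕ, qf D (F ^ k *ᵥ z) ≤ qf D z := fun k => by
    induction k with
    | zero => simp
    | succ k ih =>
      rw [pow_succ', ← Matrix.mulVec_mulVec]
      exact (hD _).trans ih
  have h2 := ((continuous_qf D).tendsto 0).comp (hF.mulVec z)
  rw [qf_zero_right] at h2
  exact le_of_tendsto' h2 h1

end Powers

/-! ### Linear-quadratic control with a detectable stage cost -/

section LQ

variable {ι κ : Type} [Fintype ι] [Fintype κ] [DecidableEq ι] [DecidableEq κ]
variable {A : Matrix ι ι ℝ} {B : Matrix ι κ ℝ} {G : Matrix ι ι ℝ} {R : Matrix κ κ ℝ}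

/-- Along every trajectory of `z_{t+1} = A z_t + B u_t`, the stage cost can tend to zero only
if the state does. -/
def StageDetectable (A : Matrix ι ι ℝ) (B : Matrix ι κ ℝ) (G : Matrix ι ι ℝ)
    (R : Matrix κ κ ℝ) : Prop :=
  ∀ (z : ℕ → ι → ℝ) (u : ℕ → κ → ℝ), (∀ t, z (t + 1) = A *ᵥ z t + B *ᵥ u t) →
    Tendsto (fun t => qf G (z t) + qf R (u t)) atTop (𝓝 0) → Tendsto z atTop (𝓝 0)

/-- The greedy gain `(R + Bᵀ X B)⁻¹ Bᵀ X A` of the value matrix `X`. -/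
noncomputable def greedyGain (A : Matrix ι ι ℝ) (B : Matrix ι κ ℝ) (R : Matrix κ κ ℝ)
    (X : Matrix ι ι ℝ) : Matrix κ ι ℝ :=
  (R + Bᵀ * X * B)⁻¹ * Bᵀ * X * A

/-- One step of the value recursion of the feedback `u = -K z`. -/
def policyMap (A : Matrix ι ι ℝ) (B : Matrix ι κ ℝ) (G : Matrix ι ι ℝ) (R : Matrix κ κ ℝ)
    (K : Matrix κ ι ℝ) (X : Matrix ι ι ℝ) : Matrix ι ι ℝ :=
  G + Kᵀ * R * K + (A - B * K)ᵀ * X * (A - B * K)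

lemma qf_policyMap (K : Matrix κ ι ℝ) (X : Matrix ι ι ℝ) (z : ι → ℝ) :
    qf (policyMap A B G R K X) z =
      qf G z + qf R (-(K *ᵥ z)) + qf X (A *ᵥ z + B *ᵥ -(K *ᵥ z)) := by
  rw [policyMap, qf_add, qf_add, qf_conj, qf_conj, qf_neg_right]
  rw [Matrix.sub_mulVec, Matrix.mulVec_neg, ← Matrix.mulVec_mulVec, ← sub_eq_add_neg]

lemma policyMap_posSemidef (hG : G.PosSemidef) (hR : R.PosSemidef) {X : Matrix ι ι ℝ}
    (hX : X.PosSemidef) (K : Matrix κ ι ℝ) : (policyMap A B G R K X).PosSemidef :=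
  (hG.add (posSemidef_conj hR K)).add (posSemidef_conj hX _)

lemma inputWeight_posDef (hR : R.PosDef) {X : Matrix ι ι ℝ} (hX : X.PosSemidef) :
    (R + Bᵀ * X * B).PosDef :=
  hR.add_posSemidef (posSemidef_conj hX B)

lemma inputWeight_isUnit_det (hR : R.PosDef) {X : Matrix ι ι ℝ} (hX : X.PosSemidef) :
    IsUnit (R + Bᵀ * X * B).det :=
  (Matrix.isUnit_iff_isUnit_det _).1 (inputWeight_posDef hR hX).isUnit

lemma inputWeight_mul_greedyGain (hR : R.PosDef) {X : Matrix ι ι ℝ} (hX : X.PosSemidef) :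
    (R + Bᵀ * X * B) * greedyGain A B R X = Bᵀ * X * A := by
  rw [greedyGain]
  simp only [Matrix.mul_assoc]
  rw [← Matrix.mul_assoc Bᵀ X B, Matrix.mul_nonsing_inv_cancel_left _ _ (inputWeight_isUnit_det hR hX)]

/-- Completion of the square. -/
lemma stage_add_qf_next (hR : R.PosDef) {X : Matrix ι ι ℝ} (hX : X.PosSemidef)
    (z : ι → ℝ) (u : κ → ℝ) :
    qf G z + qf R u + qf X (A *ᵥ z + B *ᵥ u) =
      qf (policyMap A B G R (greedyGain A B R X) X) z +
        qf (R + Bᵀ * X * B) (u + greedyGain A B R X *ᵥ z) := by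
  have hS := inputWeight_posDef (B := B) hR hX
  set S := R + Bᵀ * X * B with hSdef
  set w := greedyGain A B R X *ᵥ z with hw
  have key : ∀ v : κ → ℝ, qf G z + qf R v + qf X (A *ᵥ z + B *ᵥ v) =
      qf G z + qf X (A *ᵥ z) + 2 * (v ⬝ᵥ (S *ᵥ w)) + qf S v := by
    intro v
    have h1 : S *ᵥ w = Bᵀ *ᵥ (X *ᵥ (A *ᵥ z)) := by
      rw [hw, Matrix.mulVec_mulVec, inputWeight_mul_greedyGain hR hX]
      simp [← Matrix.mulVec_mulVec]
    rw [qf_add_right hX.isSymm, h1, hSdef, qf_add, qf_conj, Matrix.dotProduct_mulVec v,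
      Matrix.vecMul_transpose]
    ring
  rw [qf_policyMap, key, key, qf_add_right hS.posSemidef.isSymm u w, qf_neg_right,
    dotProduct_symm hS.posSemidef.isSymm u w, neg_dotProduct]
  change _ = _ + (_ + 2 * _ + w ⬝ᵥ (S *ᵥ w))
  have : qf S w = w ⬝ᵥ (S *ᵥ w) := rfl
  rw [this]; ring

/-- Completion of the square at `u = -K z`. The excess over the greedy gain is a square in the gain
difference; this drives both policy improvement and the quadratic rate. -/
lemma policyMap_eq_greedy_add (hG : G.PosSemidef) (hR : R.PosDef) {X : Matrix ι ι ℝ}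
    (hX : X.PosSemidef) (K : Matrix κ ι ℝ) :
    policyMap A B G R K X = policyMap A B G R (greedyGain A B R X) X +
      (K - greedyGain A B R X)ᵀ * (R + Bᵀ * X * B) * (K - greedyGain A B R X) := by
  refine eq_of_qf_eq (policyMap_posSemidef hG hR.posSemidef hX K).isSymm
    ((policyMap_posSemidef hG hR.posSemidef hX _).add
      (posSemidef_conj (inputWeight_posDef hR hX).posSemidef _)).isSymm fun z => ?_
  have h1 : (K - greedyGain A B R X) *ᵥ z = -(-(K *ᵥ z) + greedyGain A B R X *ᵥ z) := by
    rw [Matrix.sub_mulVec]; abel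
  rw [qf_policyMap, stage_add_qf_next hR hX, 
    qf_add (policyMap A B G R (greedyGain A B R X) X), qf_conj, h1, qf_neg_right]

/-- Identifies fixed points of the greedy value recursion with solutions of the Riccati equation. -/
lemma policyMap_greedy (hR : R.PosDef) {X : Matrix ι ι ℝ} (hX : X.PosSemidef) :
    policyMap A B G R (greedyGain A B R X) X =
      G + Aᵀ * X * A - Aᵀ * X * B * (R + Bᵀ * X * B)⁻¹ * Bᵀ * X * A := by
  have h1 := inputWeight_mul_greedyGain (A := A) (B := B) hR hX
  have h2 : Aᵀ * X * B * (R + Bᵀ * X * B)⁻¹ * Bᵀ * X * A =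
      Aᵀ * X * B * greedyGain A B R X := by simp only [greedyGain, Matrix.mul_assoc]
  rw [h2, policyMap]
  set K := greedyGain A B R X
  have h3 : Kᵀ * (R * K) + Kᵀ * (Bᵀ * (X * (B * K))) = Kᵀ * (Bᵀ * (X * A)) := by
    have := congrArg (fun Y => Kᵀ * Y) h1
    simpa only [Matrix.add_mul, Matrix.mul_add, Matrix.mul_assoc] using this
  simp only [Matrix.transpose_sub, Matrix.transpose_mul, Matrix.mul_sub, Matrix.sub_mul,
    Matrix.mul_assoc]
  rw [← h3]; abel

lemma sum_stage_le {X : Matrix ι ι ℝ} {z : ℕ → ι → ℝ} {s : ℕ → ℝ}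
    (h : ∀ t, s t + qf X (z (t + 1)) ≤ qf X (z t)) (N : ℕ) :
    ∑ t ∈ Finset.range N, s t + qf X (z N) ≤ qf X (z 0) := by
  induction N with
  | zero => simp
  | succ N ih => rw [Finset.sum_range_succ]; linarith [h N]

lemma le_sum_stage {X : Matrix ι ι ℝ} {z : ℕ → ι → ℝ} {s : ℕ → ℝ}
    (h : ∀ t, qf X (z t) ≤ s t + qf X (z (t + 1))) (N : ℕ) :
    qf X (z 0) ≤ ∑ t ∈ Finset.range N, s t + qf X (z N) := by
  induction N with
  | zero => simp
  | succ N ih => rw [Finset.sum_range_succ]; linarith [h N]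

/-- A value matrix that decreases at least by the stage cost certifies stability. -/
lemma StageDetectable.powTendsto (hdet : StageDetectable A B G R) (hG : G.PosSemidef)
    (hR : R.PosDef) {X : Matrix ι ι ℝ} (hX : X.PosSemidef) {K : Matrix κ ι ℝ}
    (h : ∀ z, qf (policyMap A B G R K X) z ≤ qf X z) : PowTendsto (A - B * K) := by
  refine powTendsto_of_mulVec fun z₀ => ?_
  set z : ℕ → ι → ℝ := fun t => (A - B * K) ^ t *ᵥ z₀ with hz
  have hstep : ∀ t, z (t + 1) = A *ᵥ z t + B *ᵥ -(K *ᵥ z t) := fun t => by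
    simp only [hz, pow_succ', ← Matrix.mulVec_mulVec]
    rw [Matrix.sub_mulVec, Matrix.mulVec_neg, ← Matrix.mulVec_mulVec, sub_eq_add_neg]
  refine hdet z (fun t => -(K *ᵥ z t)) hstep ?_
  have hsum : Summable fun t => qf G (z t) + qf R (-(K *ᵥ z t)) := by
    refine summable_of_sum_range_le (c := qf X (z 0))
      (fun t => add_nonneg (hG.qf_nonneg _) (hR.posSemidef.qf_nonneg _)) fun N => ?_
    have := sum_stage_le (X := X) (z := z) (s := fun t => qf G (z t) + qf R (-(K *ᵥ z t)))
      (fun t => by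
        have := h (z t)
        rwa [qf_policyMap, ← hstep] at this) N
    linarith [hX.qf_nonneg (z N)]
  exact hsum.tendsto_atTop_zero

/-- Positive semidefinite solutions of the Riccati equation are ordered, hence unique. -/
lemma StageDetectable.riccati_unique (hdet : StageDetectable A B G R) (hG : G.PosSemidef)
    (hR : R.PosDef) {X Y : Matrix ι ι ℝ} (hX : X.PosSemidef) (hY : Y.PosSemidef)
    (hXe : X = policyMap A B G R (greedyGain A B R X) X)
    (hYe : Y = policyMap A B G R (greedyGain A B R Y) Y) : X = Y := by
  have main : ∀ {X Y : Matrix ι ι ℝ}, X.PosSemidef → Y.PosSemidef →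
      X = policyMap A B G R (greedyGain A B R X) X →
      Y = policyMap A B G R (greedyGain A B R Y) Y → ∀ z, qf X z ≤ qf Y z := by
    intro X Y hX hY hXe hYe z
    have hF : PowTendsto (A - B * greedyGain A B R Y) :=
      hdet.powTendsto hG hR hY fun z => by rw [← hYe]
    -- Under the feedback of `Y`, the value `Y` drops by exactly the stage cost and `X` by at most
    -- that, so `Y - X` does not increase along a stable closed loop.
    have := hF.qf_nonneg (D := Y - X) (fun z => ?_) z
    · rw [qf_sub] at this; linarith
    have h1 := stage_add_qf_next (A := A) (B := B) (G := G) hR hX z (-(greedyGain A B R Y *ᵥ z))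
    have h2 := qf_policyMap (A := A) (B := B) (G := G) (R := R) (greedyGain A B R Y) Y z
    rw [← hXe] at h1
    rw [← hYe] at h2
    have h3 := (inputWeight_posDef (B := B) hR hX).posSemidef.qf_nonneg
      (-(greedyGain A B R Y *ᵥ z) + greedyGain A B R X *ᵥ z)
    have h4 : (A - B * greedyGain A B R Y) *ᵥ z = A *ᵥ z + B *ᵥ -(greedyGain A B R Y *ᵥ z) := by
      rw [Matrix.sub_mulVec, Matrix.mulVec_neg, ← Matrix.mulVec_mulVec, sub_eq_add_neg]
    rw [h4, qf_sub, qf_sub]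
    linarith
  exact eq_of_qf_eq hX.isSymm hY.isSymm fun z =>
    le_antisymm (main hX hY hXe hYe z) (main hY hX hYe hXe z)

/-- The inverse is adjugate over determinant, and the limiting determinant is nonzero because the
limit weight is positive definite. -/
lemma tendsto_greedyGain (hR : R.PosDef) {X : ℕ → Matrix ι ι ℝ} {Y : Matrix ι ι ℝ}
    (hY : Y.PosSemidef) (h : Tendsto X atTop (𝓝 Y)) :
    Tendsto (fun i => (R + Bᵀ * X i * B)⁻¹) atTop (𝓝 (R + Bᵀ * Y * B)⁻¹) ∧
      Tendsto (fun i => greedyGain A B R (X i)) atTop (𝓝 (greedyGain A B R Y)) := by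
  have hu := inputWeight_isUnit_det (B := B) hR hY
  have hS : Tendsto (fun i => R + Bᵀ * X i * B) atTop (𝓝 (R + Bᵀ * Y * B)) := by
    have hc : Continuous fun X : Matrix ι ι ℝ => R + Bᵀ * X * B := by fun_prop
    exact (hc.tendsto Y).comp h
  have hinv : Tendsto (fun i => (R + Bᵀ * X i * B)⁻¹) atTop (𝓝 (R + Bᵀ * Y * B)⁻¹) := by
    simp only [Matrix.inv_def, Ring.inverse_eq_inv']
    have hdet : Continuous fun M : Matrix κ κ ℝ => M.det := continuous_id.matrix_det
    have hadj : Continuous fun M : Matrix κ κ ℝ => M.adjugate := continuous_id.matrix_adjugate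
    exact (((hdet.tendsto _).comp hS).inv₀ hu.ne_zero).smul ((hadj.tendsto _).comp hS)
  refine ⟨hinv, ?_⟩
  have hc : Continuous fun q : Matrix κ κ ℝ × Matrix ι ι ℝ => q.1 * Bᵀ * q.2 * A := by fun_prop
  have := (hc.tendsto ((R + Bᵀ * Y * B)⁻¹, Y)).comp (hinv.prodMk_nhds h)
  exact this

lemma continuous_policyMap :
    Continuous fun q : Matrix κ ι ℝ × Matrix ι ι ℝ => policyMap A B G R q.1 q.2 := by
  unfold policyMap; fun_prop

/-- Value iteration: if every initial state admits an input of finite cost, then the Riccati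
equation has a positive semidefinite solution. -/
lemma exists_riccati (hG : G.PosSemidef) (hR : R.PosDef)
    (hfin : ∀ z₀ : ι → ℝ, ∃ (z : ℕ → ι → ℝ) (u : ℕ → κ → ℝ) (c : ℝ), z 0 = z₀ ∧
      (∀ t, z (t + 1) = A *ᵥ z t + B *ᵥ u t) ∧
      ∀ N, ∑ t ∈ Finset.range N, (qf G (z t) + qf R (u t)) ≤ c) :
    ∃ X : Matrix ι ι ℝ, X.PosSemidef ∧ X = policyMap A B G R (greedyGain A B R X) X := by
  -- `V k` is the optimal cost over `k` steps without terminal cost: it increases with `k` and is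
  -- bounded by the cost of any infinite trajectory from the same state.
  set V : ℕ → Matrix ι ι ℝ := fun k =>
    (fun X => policyMap A B G R (greedyGain A B R X) X)^[k] 0 with hV
  have hs : ∀ k, V (k + 1) = policyMap A B G R (greedyGain A B R (V k)) (V k) := fun k =>
    Function.iterate_succ_apply' _ _ _
  have hp : ∀ k, (V k).PosSemidef := fun k => by
    induction k with
    | zero => exact Matrix.PosSemidef.zero
    | succ k ih => rw [hs]; exact policyMap_posSemidef hG hR.posSemidef ih _
  have hopt : ∀ k z u, qf (V (k + 1)) z ≤ qf G z + qf R u + qf (V k) (A *ᵥ z + B *ᵥ u) := by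
    intro k z u
    rw [stage_add_qf_next hR (hp k), ← hs]
    linarith [(inputWeight_posDef (B := B) hR (hp k)).posSemidef.qf_nonneg
      (u + greedyGain A B R (V k) *ᵥ z)]
  have hmono : ∀ k z, qf (V k) z ≤ qf (V (k + 1)) z := fun k => by
    induction k with
    | zero => intro z; rw [show V 0 = 0 from rfl, qf_zero_left]; exact (hp _).qf_nonneg z
    | succ k ih =>
      intro z
      rw [hs (k + 1), qf_policyMap]
      refine (hopt k z (-(greedyGain A B R (V (k + 1)) *ᵥ z))).trans ?_
      linarith [ih (A *ᵥ z + B *ᵥ -(greedyGain A B R (V (k + 1)) *ᵥ z))]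
  have hbd : ∀ N (z : ℕ → ι → ℝ) (u : ℕ → κ → ℝ), (∀ t, z (t + 1) = A *ᵥ z t + B *ᵥ u t) →
      qf (V N) (z 0) ≤ ∑ t ∈ Finset.range N, (qf G (z t) + qf R (u t)) := fun N => by
    induction N with
    | zero => intro z u _; simp [show V 0 = 0 from rfl, qf_zero_left]
    | succ N ih =>
      intro z u hz
      rw [Finset.sum_range_succ', add_comm (Finset.sum _ _)]
      refine (hopt N (z 0) (u 0)).trans ?_
      rw [← hz 0]
      linarith [ih (fun t => z (t + 1)) (fun t => u (t + 1)) fun t => hz (t + 1)]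
  obtain ⟨X, hX⟩ := exists_tendsto_of_qf (fun k => (hp k).isSymm) fun z₀ => by
    obtain ⟨z, u, c, hz0, hz, hc⟩ := hfin z₀
    refine ⟨_, tendsto_atTop_ciSup (monotone_nat_of_le_succ fun k => hmono k z₀)
      ⟨c, ?_⟩⟩
    rintro _ ⟨N, rfl⟩
    exact (hz0 ▸ hbd N z u hz).trans (hc N)
  have hXp := posSemidef_of_tendsto hp hX
  refine ⟨X, hXp, tendsto_nhds_unique ((tendsto_add_atTop_iff_nat 1).2 hX) ?_⟩
  simp only [hs]
  have := ((continuous_policyMap (A := A) (B := B) (G := G) (R := R)).tendsto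
    (greedyGain A B R X, X)).comp ((tendsto_greedyGain hR hXp hX).2.prodMk_nhds hX)
  exact this

/-- The value equation of a fixed gain is a Stein equation. Its solution is nonnegative because it
does not increase along the stable closed loop. -/
lemma PowTendsto.exists_value (hG : G.PosSemidef) (hR : R.PosDef) {K : Matrix κ ι ℝ}
    (hK : PowTendsto (A - B * K)) :
    ∃ X : Matrix ι ι ℝ, X.PosSemidef ∧ X = policyMap A B G R K X := by
  obtain ⟨X, hX⟩ := hK.exists_stein (G + Kᵀ * R * K)
  have hE := hG.add (posSemidef_conj hR.posSemidef K)
  refine ⟨X, posSemidef_iff_qf.2 ⟨hK.stein_isSymm hE.isSymm hX, fun z => ?_⟩, hX⟩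
  refine hK.qf_nonneg (fun z => ?_) z
  conv_rhs => rw [hX]
  rw [qf_add, qf_conj]
  linarith [hE.qf_nonneg z]

/-- Policy improvement preserves stability. -/
lemma StageDetectable.powTendsto_greedy (hdet : StageDetectable A B G R) (hG : G.PosSemidef)
    (hR : R.PosDef) {X : Matrix ι ι ℝ} (hX : X.PosSemidef) {K : Matrix κ ι ℝ}
    (hXe : X = policyMap A B G R K X) :
    (∀ z, qf (policyMap A B G R (greedyGain A B R X) X) z ≤ qf X z) ∧
      PowTendsto (A - B * greedyGain A B R X) := by
  have h : ∀ z, qf (policyMap A B G R (greedyGain A B R X) X) z ≤ qf X z := fun z => by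
    conv_rhs => rw [hXe, policyMap_eq_greedy_add hG hR hX, qf_add, qf_conj]
    linarith [(inputWeight_posDef (B := B) hR hX).posSemidef.qf_nonneg
      ((K - greedyGain A B R X) *ᵥ z)]
  exact ⟨h, hdet.powTendsto hG hR hX h⟩

/-- In a continuous family of endomorphisms, the injective ones are uniformly bounded below along
a convergent sequence of parameters. -/
lemma exists_injective_bound {α E : Type} [TopologicalSpace α] [NormedAddCommGroup E]
    [NormedSpace ℝ E] [FiniteDimensional ℝ E] {L : α → E →ₗ[ℝ] E} {F : ℕ → α} {F' : α}
    (hL : ∀ i, Function.Injective (L (F i))) (hL' : Function.Injective (L F'))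
    (hc : ∀ x, Continuous fun a => L a x) (h : Tendsto F atTop (𝓝 F')) :
    ∃ c : ℝ, 0 ≤ c ∧ ∀ i x, ‖x‖ ≤ c * ‖L (F i) x‖ := by
  have : CompleteSpace E := FiniteDimensional.complete ℝ E
  let M : (E →ₗ[ℝ] E) → (E →L[ℝ] E) := fun f => LinearMap.toContinuousLinearMap f
  have hMu : ∀ f : E →ₗ[ℝ] E, Function.Injective f → IsUnit (M f) := fun f hf => by
    let e := (LinearEquiv.ofBijective f
      ⟨hf, LinearMap.injective_iff_surjective.1 hf⟩).toContinuousLinearEquiv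
    exact ⟨e.toUnit, by ext1 X; rfl⟩
  have hMc : Continuous fun a => M (L a) := continuous_clm_apply.2 hc
  -- Inversion is continuous at units, so the inverses converge and their norms are bounded.
  have ht : Tendsto (fun i => Ring.inverse (M (L (F i)))) atTop (𝓝 (Ring.inverse (M (L F')))) := by
    obtain ⟨v, hv⟩ := hMu (L F') hL'
    have := NormedRing.inverse_continuousAt v
    rw [hv] at this
    exact this.tendsto.comp ((hMc.tendsto F').comp h)
  obtain ⟨c, hc⟩ := ht.norm.bddAbove_range
  refine ⟨max c 0, le_max_right _ _, fun i x => ?_⟩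
  have h1 : x = Ring.inverse (M (L (F i))) (L (F i) x) := by
    change x = (Ring.inverse (M (L (F i))) * M (L (F i))) x
    rw [Ring.inverse_mul_cancel _ (hMu _ (hL i))]; rfl
  calc ‖x‖ = ‖Ring.inverse (M (L (F i))) (L (F i) x)‖ := by rw [← h1]
    _ ≤ ‖Ring.inverse (M (L (F i)))‖ * ‖L (F i) x‖ := ContinuousLinearMap.le_opNorm _ _
    _ ≤ max c 0 * ‖L (F i) x‖ := by
      gcongr
      exact (hc ⟨i, rfl⟩).trans (le_max_left _ _)

section Norm

attribute [local instance] Matrix.normedAddCommGroup Matrix.normedSpace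

lemma frobNorm_le_card_mul_norm (M : Matrix κ ι ℝ) :
    frobNorm M ≤ (Fintype.card κ * Fintype.card ι + 1) * ‖M‖ := by
  refine Real.sqrt_le_iff.2 ⟨by positivity, ?_⟩
  calc ∑ i, ∑ j, M i j ^ 2 ≤ ∑ _i : κ, ∑ _j : ι, ‖M‖ ^ 2 := by
        refine Finset.sum_le_sum fun i _ => Finset.sum_le_sum fun j _ => ?_
        rw [← sq_abs (M i j), ← Real.norm_eq_abs]
        gcongr
        exact Matrix.norm_entry_le_entrywise_sup_norm M
    _ = (Fintype.card κ * Fintype.card ι : ℝ) * ‖M‖ ^ 2 := by simp; ring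
    -- The estimate `a ≤ (a + 1) ^ 2` avoids a square root in the constant.
    _ ≤ (Fintype.card κ * Fintype.card ι + 1 : ℝ) ^ 2 * ‖M‖ ^ 2 := by
        gcongr
        have : (0 : ℝ) ≤ Fintype.card κ * Fintype.card ι := by positivity
        nlinarith
    _ = _ := by ring

lemma norm_le_frobNorm (M : Matrix κ ι ℝ) : ‖M‖ ≤ frobNorm M := by
  refine (Matrix.norm_le_iff (Real.sqrt_nonneg _)).2 fun i j => Real.le_sqrt_of_sq_le ?_
  rw [Real.norm_eq_abs, sq_abs]
  calc M i j ^ 2 ≤ ∑ j, M i j ^ 2 :=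
        Finset.single_le_sum (f := fun j => M i j ^ 2) (fun _ _ => sq_nonneg _) (Finset.mem_univ j)
    _ ≤ _ := Finset.single_le_sum (f := fun i => ∑ j, M i j ^ 2)
        (fun _ _ => Finset.sum_nonneg fun _ _ => sq_nonneg _) (Finset.mem_univ i)

/-- The entrywise supremum norm is not submultiplicative; the inner dimension makes up for it. -/
lemma norm_mul_le_card {α β γ : Type} [Fintype α] [Fintype β] [Fintype γ] (M : Matrix α β ℝ)
    (N : Matrix β γ ℝ) : ‖M * N‖ ≤ Fintype.card β * ‖M‖ * ‖N‖ := by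
  refine (Matrix.norm_le_iff (by positivity)).2 fun i j => ?_
  rw [Matrix.mul_apply]
  calc ‖∑ k, M i k * N k j‖ ≤ ∑ k, ‖M i k * N k j‖ := norm_sum_le _ _
    _ ≤ ∑ _k : β, ‖M‖ * ‖N‖ := by
        refine Finset.sum_le_sum fun k _ => ?_
        rw [norm_mul]
        exact mul_le_mul (Matrix.norm_entry_le_entrywise_sup_norm M)
          (Matrix.norm_entry_le_entrywise_sup_norm N) (norm_nonneg _) (norm_nonneg _)
    _ = _ := by simp; ring

/-- The solution of the Stein equation is bounded by a uniform multiple of its right-hand side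
along a convergent sequence of stable matrices. -/
lemma exists_stein_bound {F : ℕ → Matrix ι ι ℝ} {F' : Matrix ι ι ℝ}
    (hF : ∀ i, PowTendsto (F i)) (hF' : PowTendsto F') (h : Tendsto F atTop (𝓝 F')) :
    ∃ c : ℝ, 0 ≤ c ∧ ∀ i X, ‖X‖ ≤ c * ‖stein (F i) X‖ := by
  refine exists_injective_bound (E := Matrix ι ι ℝ) (L := stein)
    (fun i => (hF i).stein_injective) hF'.stein_injective (fun X => ?_) h
  change Continuous fun F : Matrix ι ι ℝ => X - Fᵀ * X * F
  fun_prop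

end Norm

end LQ

/-! ### Hewer's policy iteration and its quadratic rate -/

section PolicyIteration

variable {ι κ : Type} [Fintype ι] [Fintype κ] [DecidableEq ι] [DecidableEq κ]
variable {A : Matrix ι ι ℝ} {B : Matrix ι κ ℝ} {G : Matrix ι ι ℝ} {R : Matrix κ κ ℝ}

/-- Source of the quadratic rate: the value error solves a Stein equation whose right-hand side is
quadratic in the gain error. -/
lemma stein_value_sub (hG : G.PosSemidef) (hR : R.PosDef) {K : Matrix κ ι ℝ}
    {X Y : Matrix ι ι ℝ} (hY : Y.PosSemidef) (hXe : X = policyMap A B G R K X)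
    (hYe : Y = policyMap A B G R (greedyGain A B R Y) Y) :
    stein (A - B * K) (X - Y) =
      (K - greedyGain A B R Y)ᵀ * (R + Bᵀ * Y * B) * (K - greedyGain A B R Y) := by
  have h1 := policyMap_eq_greedy_add (A := A) (B := B) hG hR hY K
  rw [← hYe] at h1
  rw [← sub_eq_of_eq_add' h1, stein_apply]
  have h2 : X - (A - B * K)ᵀ * X * (A - B * K) = G + Kᵀ * R * K := sub_eq_of_eq_add hXe
  rw [policyMap, ← h2, Matrix.mul_sub (A - B * K)ᵀ, Matrix.sub_mul (_ * X)]
  abel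

/-- Subtracting the normal equations of the two gains leaves a right-hand side linear in `X - Y`;
the next gain error is thus controlled by the current value error. -/
lemma inputWeight_mul_greedyGain_sub (hR : R.PosDef) {X Y : Matrix ι ι ℝ} (hX : X.PosSemidef)
    (hY : Y.PosSemidef) :
    greedyGain A B R X - greedyGain A B R Y = (R + Bᵀ * X * B)⁻¹ *
      (Bᵀ * ((X - Y) * (A - B * greedyGain A B R Y))) := by
  have h1 := inputWeight_mul_greedyGain (A := A) (B := B) hR hX
  have h2 := inputWeight_mul_greedyGain (A := A) (B := B) hR hY
  set K := greedyGain A B R X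
  set L := greedyGain A B R Y
  have h3 : (R + Bᵀ * X * B) * (K - L) = Bᵀ * ((X - Y) * (A - B * L)) := by
    rw [Matrix.mul_sub, h1]
    simp only [Matrix.mul_sub, Matrix.sub_mul, Matrix.add_mul, Matrix.mul_assoc] at h2 ⊢
    rw [← h2]; abel
  rw [← h3, Matrix.nonsing_inv_mul_cancel_left _ _ (inputWeight_isUnit_det hR hX)]

section Norm

attribute [local instance] Matrix.normedAddCommGroup Matrix.normedSpace

/-- Policy iteration converges quadratically as soon as its gains converge. -/
lemma exists_quadratic_rate (hG : G.PosSemidef) (hR : R.PosDef) {K : ℕ → Matrix κ ι ℝ}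
    {X : ℕ → Matrix ι ι ℝ} {Y : Matrix ι ι ℝ} (hY : Y.PosSemidef)
    (hYe : Y = policyMap A B G R (greedyGain A B R Y) Y)
    (hYs : PowTendsto (A - B * greedyGain A B R Y))
    (hK : ∀ i, PowTendsto (A - B * K i)) (hX : ∀ i, (X i).PosSemidef)
    (hXe : ∀ i, X i = policyMap A B G R (K i) (X i))
    (hKs : ∀ i, K (i + 1) = greedyGain A B R (X i)) (hXt : Tendsto X atTop (𝓝 Y))
    (hKt : Tendsto K atTop (𝓝 (greedyGain A B R Y))) :
    ∃ c : ℝ, ∀ i, frobNorm (K (i + 1) - greedyGain A B R Y) ≤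
      c * frobNorm (K i - greedyGain A B R Y) ^ 2 := by
  set L := greedyGain A B R Y
  have hAt : Tendsto (fun i => A - B * K i) atTop (𝓝 (A - B * L)) := by
    have hc : Continuous fun K : Matrix κ ι ℝ => A - B * K := by fun_prop
    exact (hc.tendsto L).comp hKt
  obtain ⟨c₁, hc₁, h₁⟩ := exists_stein_bound hK hYs hAt
  obtain ⟨c₂, h₂⟩ : ∃ c₂ : ℝ, ∀ i, ‖(R + Bᵀ * X i * B)⁻¹‖ ≤ c₂ := by
    have ht := (tendsto_greedyGain (A := A) (B := B) hR hY hXt).1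
    have hn : Continuous fun M : Matrix κ κ ℝ => ‖M‖ := continuous_norm
    obtain ⟨c₂, h⟩ := ((hn.tendsto _).comp ht).bddAbove_range
    exact ⟨c₂, fun i => h ⟨i, rfl⟩⟩
  have hc₂ : 0 ≤ c₂ := (norm_nonneg _).trans (h₂ 0)
  set S := R + Bᵀ * Y * B
  set a : ℝ := Nat.cast (Fintype.card ι)
  set b : ℝ := Nat.cast (Fintype.card κ)
  -- `c₁` bounds the inverse Stein operators and `c₂` the inverse input weights, uniformly in `i`;
  -- the factors `a`, `b` are inner dimensions of matrix products.
  refine ⟨(b * a + 1) * (b * c₂ * (a * ‖Bᵀ‖ * (a * (c₁ * (b * (b * ‖S‖))) * ‖A - B * L‖))),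
    fun i => ?_⟩
  have ht : ‖(K i - L)ᵀ‖ = ‖K i - L‖ := Matrix.norm_transpose _
  calc frobNorm (K (i + 1) - L) ≤ (b * a + 1) * ‖K (i + 1) - L‖ := frobNorm_le_card_mul_norm _
    _ = (b * a + 1) * ‖(R + Bᵀ * X i * B)⁻¹ * (Bᵀ * ((X i - Y) * (A - B * L)))‖ := by
        rw [hKs, inputWeight_mul_greedyGain_sub hR (hX i) hY]
    _ ≤ (b * a + 1) * (b * c₂ * (a * ‖Bᵀ‖ * (a * (c₁ * ‖stein (A - B * K i) (X i - Y)‖) *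
          ‖A - B * L‖))) := by
        gcongr
        refine (norm_mul_le_card _ _).trans ?_
        gcongr
        · exact h₂ i
        refine (norm_mul_le_card _ _).trans ?_
        gcongr
        refine (norm_mul_le_card _ _).trans ?_
        gcongr
        exact h₁ i _
    _ ≤ (b * a + 1) * (b * c₂ * (a * ‖Bᵀ‖ * (a * (c₁ * (b * (b * ‖K i - L‖ * ‖S‖) * ‖K i - L‖)) *
          ‖A - B * L‖))) := by
        rw [stein_value_sub hG hR hY (hXe i) hYe]
        gcongr
        refine (norm_mul_le_card _ _).trans ?_
        gcongr
        refine (norm_mul_le_card _ _).trans ?_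
        rw [ht]
    _ = (b * a + 1) * (b * c₂ * (a * ‖Bᵀ‖ * (a * (c₁ * (b * (b * ‖S‖))) * ‖A - B * L‖))) *
          ‖K i - L‖ ^ 2 := by ring
    _ ≤ _ := by
        gcongr
        exact norm_le_frobNorm _

end Norm

/-- Hewer's policy iteration: from a stabilizing gain, all iterates are stabilizing and they
converge quadratically to the optimal gain. -/
theorem StageDetectable.policy_iteration (hdet : StageDetectable A B G R) (hG : G.PosSemidef)
    (hR : R.PosDef) {Y : Matrix ι ι ℝ} (hY : Y.PosSemidef)
    (hYe : Y = policyMap A B G R (greedyGain A B R Y) Y) {K₀ : Matrix κ ι ℝ}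
    (hK₀ : PowTendsto (A - B * K₀)) :
    ∃ (K : ℕ → Matrix κ ι ℝ) (X : ℕ → Matrix ι ι ℝ), K 0 = K₀ ∧
      (∀ i, PowTendsto (A - B * K i) ∧ (X i).PosSemidef ∧ X i = policyMap A B G R (K i) (X i) ∧
        K (i + 1) = greedyGain A B R (X i)) ∧
      ConvergesQuadratically K (greedyGain A B R Y) := by
  -- The default `0` makes the value function total, so the gains can be defined by plain iteration
  -- before stability is known.
  have hval : ∀ K : Matrix κ ι ℝ, ∃ X : Matrix ι ι ℝ, PowTendsto (A - B * K) →
      X.PosSemidef ∧ X = policyMap A B G R K X := fun K => by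
    by_cases h : PowTendsto (A - B * K)
    · obtain ⟨X, hX⟩ := h.exists_value hG hR
      exact ⟨X, fun _ => hX⟩
    · exact ⟨0, fun h' => absurd h' h⟩
  choose V hV using hval
  set K : ℕ → Matrix κ ι ℝ := fun i => (fun K => greedyGain A B R (V K))^[i] K₀ with hKdef
  have hKs : ∀ i, K (i + 1) = greedyGain A B R (V (K i)) := fun i =>
    Function.iterate_succ_apply' _ _ _
  have hK : ∀ i, PowTendsto (A - B * K i) := fun i => by
    induction i with
    | zero => exact hK₀
    | succ i ih =>
      rw [hKs]
      exact (hdet.powTendsto_greedy hG hR (hV _ ih).1 (hV _ ih).2).2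
  set X : ℕ → Matrix ι ι ℝ := fun i => V (K i) with hXdef
  have hX : ∀ i, (X i).PosSemidef := fun i => (hV _ (hK i)).1
  have hXe : ∀ i, X i = policyMap A B G R (K i) (X i) := fun i => (hV _ (hK i)).2
  -- Under the improved gain, `X i` drops by at least the stage cost and `X (i + 1)` by exactly
  -- that, so their difference does not increase along a stable closed loop.
  have hmono : ∀ i z, qf (X (i + 1)) z ≤ qf (X i) z := fun i z => by
    have := (hK (i + 1)).qf_nonneg (D := X i - X (i + 1)) (fun z => ?_) z
    · rw [qf_sub] at this; linarith
    have h1 := (hdet.powTendsto_greedy hG hR (hX i) (hXe i)).1 z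
    rw [← hKs i] at h1
    have h2 := congrArg (fun M => qf M z) (hXe (i + 1))
    simp only [policyMap, qf_add, qf_conj] at h1 h2
    rw [qf_sub, qf_sub]
    linarith
  obtain ⟨X', hXt⟩ := exists_tendsto_of_qf (fun i => (hX i).isSymm) fun z =>
    ⟨_, tendsto_atTop_ciInf (antitone_nat_of_succ_le fun i => hmono i z)
      ⟨0, by rintro _ ⟨i, rfl⟩; exact (hX i).qf_nonneg z⟩⟩
  have hX' := posSemidef_of_tendsto hX hXt
  have hKt : Tendsto K atTop (𝓝 (greedyGain A B R X')) := by
    rw [← tendsto_add_atTop_iff_nat 1]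
    simp only [hKs]
    exact (tendsto_greedyGain hR hX' hXt).2
  have hX'e : X' = policyMap A B G R (greedyGain A B R X') X' := by
    refine tendsto_nhds_unique hXt ?_
    have := ((continuous_policyMap (A := A) (B := B) (G := G) (R := R)).tendsto
      (greedyGain A B R X', X')).comp (hKt.prodMk_nhds hXt)
    exact this.congr fun i => (hXe i).symm
  obtain rfl := hdet.riccati_unique hG hR hX' hY hX'e hYe
  refine ⟨K, X, rfl, fun i => ⟨hK i, hX i, hXe i, hKs i⟩, hKt, ?_⟩
  exact exists_quadratic_rate hG hR hX' hX'e
    (hdet.powTendsto hG hR hX' fun z => by rw [← hX'e]) hK hX hXe hKs hXt hKt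

end PolicyIteration

/-! ### Rank, injectivity and surjectivity -/

section Rank

variable {α β : Type} [Fintype α] [Fintype β]

lemma mulVec_eq_zero_of_rank_eq_card {M : Matrix α β ℝ} (hM : M.rank = Fintype.card β)
    {v : β → ℝ} (hv : M *ᵥ v = 0) : v = 0 := by
  have h1 := LinearMap.finrank_range_add_finrank_ker M.mulVecLin
  have h2 : Module.finrank ℝ (LinearMap.range M.mulVecLin) = Fintype.card β := hM
  rw [h2, Module.finrank_fintype_fun_eq_card, Nat.add_eq_left, Submodule.finrank_eq_zero] at h1
  have : v ∈ LinearMap.ker M.mulVecLin := hv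
  rwa [h1, Submodule.mem_bot] at this

lemma rank_eq_card_of_mulVec {M : Matrix α β ℝ} (hM : ∀ v, M *ᵥ v = 0 → v = 0) :
    M.rank = Fintype.card β := by
  have h1 := LinearMap.finrank_range_add_finrank_ker M.mulVecLin
  rw [LinearMap.ker_eq_bot'.2 hM, finrank_bot, Module.finrank_fintype_fun_eq_card] at h1
  exact h1

lemma exists_mulVec_eq_of_rank {M : Matrix α β ℝ} (hM : M.rank = Fintype.card α) (w : α → ℝ) :
    ∃ v, M *ᵥ v = w := by
  have h2 : Module.finrank ℝ (LinearMap.range M.mulVecLin) = Module.finrank ℝ (α → ℝ) := by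
    rw [Module.finrank_fintype_fun_eq_card]; exact hM
  have h3 := Submodule.eq_top_of_finrank_eq h2
  exact LinearMap.range_eq_top.1 h3 w

end Rank

/-! ### Observability as a condition on zero-input outputs -/

section Observability

variable {m p η : ℕ} {A : Matrix (Fin η) (Fin η) ℝ} {B : Matrix (Fin η) (Fin m) ℝ}
  {C : Matrix (Fin p) (Fin η) ℝ}

lemma obsMatrix_mulVec (k : ℕ) (v : Vec η) (r : Fin k × Fin p) :
    (obsMatrix A C k *ᵥ v) r = (C *ᵥ (A ^ (r.1 : ℕ) *ᵥ v)) r.2 := by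
  rw [Matrix.mulVec_mulVec]; rfl

lemma Observable.eq_zero (hO : Observable A C) {v : Vec η}
    (hv : ∀ k : ℕ, C *ᵥ (A ^ k *ᵥ v) = 0) : v = 0 :=
  mulVec_eq_zero_of_rank_eq_card (M := obsMatrix A C η) (by rw [hO, Fintype.card_fin])
    (funext fun r => by rw [obsMatrix_mulVec, hv]; rfl)

/-- By the theorem of Cayley and Hamilton, the first `η` outputs decide whether all vanish. -/
lemma observable_of_forall (h : ∀ v : Vec η, (∀ k : ℕ, C *ᵥ (A ^ k *ᵥ v) = 0) → v = 0) :
    Observable A C := by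
  refine (rank_eq_card_of_mulVec (M := obsMatrix A C η) fun v hv => h v fun k => ?_).trans
    (Fintype.card_fin η)
  -- For `η = 0` the characteristic polynomial is `1` and the remainder has no degree below `η`.
  rcases Nat.eq_zero_or_pos η with rfl | hη
  · rw [show A ^ k *ᵥ v = 0 from Subsingleton.elim _ _, Matrix.mulVec_zero]
  have hlow : ∀ i < η, C *ᵥ (A ^ i *ᵥ v) = 0 := fun i hi => by
    ext j
    have := congrFun hv (⟨i, hi⟩, j)
    rwa [obsMatrix_mulVec] at this
  have : Nonempty (Fin η) := ⟨⟨0, hη⟩⟩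
  have hdeg : ((Polynomial.X : Polynomial ℝ) ^ k %ₘ A.charpoly).natDegree < η := by
    have hne : A.charpoly ≠ 1 := fun h1 => by
      have := A.charpoly_natDegree_eq_dim
      rw [h1, Polynomial.natDegree_one, Fintype.card_fin] at this
      omega
    have := Polynomial.natDegree_modByMonic_lt ((Polynomial.X : Polynomial ℝ) ^ k)
      A.charpoly_monic hne
    rwa [A.charpoly_natDegree_eq_dim, Fintype.card_fin] at this
  rw [Matrix.pow_eq_aeval_mod_charpoly, Polynomial.aeval_eq_sum_range' hdeg,
    Matrix.sum_mulVec, Matrix.mulVec_sum]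
  refine Finset.sum_eq_zero fun i hi => ?_
  rw [Matrix.smul_mulVec, Matrix.mulVec_smul, hlow i (Finset.mem_range.1 hi), smul_zero]

end Observability

/-! ### Observable embeddings and transfer of stabilizability -/

section KLE

variable {n m p : ℕ} {f : Vec n → Vec m → Vec n} {h : Vec n → Vec p}

/-- Restricting the observables to the span of the rows of all `C A ^ k` gives an observable
embedding. -/
theorem AdmitsKLE.exists_observable (hK : AdmitsKLE f h) :
    ∃ (η : ℕ) (Ψ : Vec n → Vec η) (A : Matrix (Fin η) (Fin η) ℝ) (B : Matrix (Fin η) (Fin m) ℝ)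
      (C : Matrix (Fin p) (Fin η) ℝ), IsKLE f h Ψ A B C ∧ Observable A C := by
  obtain ⟨η, Ψ, A, B, C, hli, hf, hh⟩ := hK
  let W : Submodule ℝ (Vec η) :=
    Submodule.span ℝ (Set.range fun q : ℕ × Fin p => (C * A ^ q.1) q.2)
  let b := Module.finBasis ℝ W
  let L : Matrix (Fin (Module.finrank ℝ W)) (Fin η) ℝ := Matrix.of fun i => (b i : Vec η)
  have hL : ∀ w ∈ W, ∃ c, c ᵥ* L = w := fun w hw => by
    refine ⟨b.repr ⟨w, hw⟩, ?_⟩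
    rw [Matrix.vecMul_eq_sum]
    calc ∑ i, b.repr ⟨w, hw⟩ i • L i = ((∑ i, b.repr ⟨w, hw⟩ i • b i : W) : Vec η) := by
          push_cast; rfl
      _ = w := by rw [b.sum_repr]
  have hLi : ∀ g, g ᵥ* L = 0 → g = 0 := fun g hg => by
    have hb : LinearIndependent ℝ fun i => (b i : Vec η) :=
      b.linearIndependent.map' W.subtype W.ker_subtype
    rw [Matrix.vecMul_eq_sum] at hg
    exact funext fun i => Fintype.linearIndependent_iff.1 hb g hg i
  have hLs : ∀ v, ∃ x, L *ᵥ x = v := by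
    refine exists_mulVec_eq_of_rank ?_
    rw [← Matrix.rank_transpose]
    exact rank_eq_card_of_mulVec fun g hg => hLi g (by rwa [Matrix.mulVec_transpose] at hg)
  -- Multiplication by `A` raises the exponent of a generator by one. Hence `L A` factors through
  -- `L`, which defines the reduced dynamics `A'`.
  have hWA : ∀ w ∈ W, w ᵥ* A ∈ W := fun w hw => by
    have : W ≤ W.comap A.vecMulLinear := by
      refine Submodule.span_le.2 ?_
      rintro _ ⟨⟨k, j⟩, rfl⟩
      refine Submodule.subset_span ⟨(k + 1, j), ?_⟩
      rw [Matrix.vecMulLinear_apply]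
      dsimp only
      rw [pow_succ, ← Matrix.mul_assoc]
      rfl
    exact this hw
  choose a ha using fun i => hL (L i ᵥ* A) (hWA _ (b i).2)
  choose c hc using fun j => hL (C j) (Submodule.subset_span ⟨(0, j), by simp⟩)
  let A' : Matrix (Fin (Module.finrank ℝ W)) (Fin (Module.finrank ℝ W)) ℝ := Matrix.of a
  let C' : Matrix (Fin p) (Fin (Module.finrank ℝ W)) ℝ := Matrix.of c
  have hA' : A' * L = L * A := Matrix.ext fun i j => congrFun (ha i) j
  have hC' : C' * L = C := Matrix.ext fun i j => congrFun (hc i) j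
  have hpow : ∀ k, A' ^ k * L = L * A ^ k := fun k => by
    induction k with
    | zero => simp
    | succ k ih =>
      rw [pow_succ', pow_succ', Matrix.mul_assoc, ih, ← Matrix.mul_assoc, hA', Matrix.mul_assoc]
  refine ⟨Module.finrank ℝ W, fun x => L *ᵥ Ψ x, A', L * B, C', ⟨?_, fun x u => ?_, fun x => ?_⟩,
    observable_of_forall fun v hv => ?_⟩
  · rw [Fintype.linearIndependent_iff] at hli ⊢
    intro g hg i
    refine congrFun (hLi g (funext fun j => hli (g ᵥ* L) ?_ j)) i
    funext x
    have := congrFun hg x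
    simp only [Finset.sum_apply, Pi.smul_apply, smul_eq_mul, Pi.zero_apply] at this ⊢
    change g ⬝ᵥ (L *ᵥ Ψ x) = 0 at this
    rwa [Matrix.dotProduct_mulVec] at this
  · simp only [hf, Matrix.mulVec_add, Matrix.mulVec_mulVec, hA']
  · rw [hh, Matrix.mulVec_mulVec, hC']
  · obtain ⟨x, rfl⟩ := hLs v
    -- Zero outputs from `L x` mean that `x` is orthogonal to all generators of `W`, hence to the
    -- rows of `L`.
    have hx : ∀ w ∈ W, w ⬝ᵥ x = 0 := fun w hw => by
      induction hw using Submodule.span_induction with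
      | mem w hw =>
        obtain ⟨⟨k, j⟩, rfl⟩ := hw
        have := congrFun (hv k) j
        rwa [Matrix.mulVec_mulVec, Matrix.mulVec_mulVec, Matrix.mul_assoc, hpow,
          ← Matrix.mul_assoc, hC'] at this
      | zero => simp
      | add w w' _ _ h1 h2 => rw [add_dotProduct, h1, h2, add_zero]
      | smul r w _ h1 => rw [smul_dotProduct, h1, smul_zero]
    exact funext fun i => hx _ (b i).2

variable {η : ℕ} {Ψ : Vec n → Vec η} {A : Matrix (Fin η) (Fin η) ℝ}
  {B : Matrix (Fin η) (Fin m) ℝ} {C : Matrix (Fin p) (Fin η) ℝ}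

lemma IsKLE.isLinTrajectory (hK : IsKLE f h Ψ A B C) {x : ℕ → Vec n} {u : ℕ → Vec m}
    {y : ℕ → Vec p} (hx : IsTrajectory f h x u y) :
    IsLinTrajectory A B C (fun t => Ψ (x t)) u y :=
  ⟨fun t => by simp only [hx.1 t, hK.2.1], fun t => by simp only [hx.2 t, hK.2.2]⟩

/-- `Ψ 0` is fixed by `A` and has zero output, so it is unobservable. -/
lemma IsKLE.map_zero (hK : IsKLE f h Ψ A B C) (hO : Observable A C) (hf0 : f 0 0 = 0)
    (hh0 : h 0 = 0) : Ψ 0 = 0 := by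
  have h1 : A *ᵥ Ψ 0 = Ψ 0 := by simpa [hf0] using (hK.2.1 0 0).symm
  have h2 : ∀ k : ℕ, A ^ k *ᵥ Ψ 0 = Ψ 0 := fun k => by
    induction k with
    | zero => simp
    | succ k ih => rw [pow_succ, ← Matrix.mulVec_mulVec, h1, ih]
  exact hO.eq_zero fun k => by rw [h2, ← hK.2.2, hh0]

/-- The observables are a linear image of finitely many outputs, hence continuous. -/
lemma IsKLE.continuous (hK : IsKLE f h Ψ A B C) (hO : Observable A C)
    (hf : Continuous fun q : Vec n × Vec m => f q.1 q.2) (hh : Continuous h) : Continuous Ψ := by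
  have h1 : ∀ (k : ℕ) x, A ^ k *ᵥ Ψ x = Ψ ((fun x => f x 0)^[k] x) := fun k x => by
    induction k with
    | zero => simp
    | succ k ih =>
      rw [pow_succ', ← Matrix.mulVec_mulVec, ih, Function.iterate_succ_apply', hK.2.1]
      simp
  have hf0 : Continuous fun x => f x 0 := hf.comp (Continuous.prodMk_left 0)
  have h2 : Continuous fun x => obsMatrix A C η *ᵥ Ψ x := by
    refine continuous_pi fun r => ?_
    simp only [obsMatrix_mulVec, h1, ← hK.2.2]
    exact (continuous_apply r.2).comp (hh.comp (hf0.iterate _))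
  obtain ⟨g, hg⟩ := LinearMap.exists_leftInverse_of_injective (obsMatrix A C η).mulVecLin
    (LinearMap.ker_eq_bot'.2 fun v hv => mulVec_eq_zero_of_rank_eq_card
      (by rw [Fintype.card_fin]; exact hO) hv)
  have h3 : Ψ = fun x => g (obsMatrix A C η *ᵥ Ψ x) :=
    funext fun x => (LinearMap.congr_fun hg (Ψ x)).symm
  rw [h3]
  exact g.continuous_of_finiteDimensional.comp h2

/-- A functional vanishing on the range of `Ψ` is a linear relation between the observables. -/
lemma IsKLE.span_range (hK : IsKLE f h Ψ A B C) : Submodule.span ℝ (Set.range Ψ) = ⊤ := by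
  by_contra hne
  obtain ⟨g, hg0, hg⟩ := Submodule.exists_le_ker_of_lt_top _ (lt_top_iff_ne_top.2 hne)
  apply hg0
  have hv : ∀ v, g v = ∑ i, g (Pi.single i 1) * v i := fun v => by
    conv_lhs => rw [← Finset.univ_sum_single v, map_sum]
    refine Finset.sum_congr rfl fun i _ => ?_
    rw [mul_comm, ← smul_eq_mul, ← map_smul, ← Pi.single_smul', smul_eq_mul, mul_one]
  have h0 := Fintype.linearIndependent_iff.1 hK.1 (fun i => g (Pi.single i 1)) <| funext fun x => by
    have : g (Ψ x) = 0 := hg (Submodule.subset_span ⟨x, rfl⟩)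
    rw [hv] at this
    simpa [Finset.sum_apply] using this
  ext i
  simpa using h0 i

/-- The states that some input drives to the origin form a subspace. -/
def nullControllable (A : Matrix (Fin η) (Fin η) ℝ) (B : Matrix (Fin η) (Fin m) ℝ) :
    Submodule ℝ (Vec η) where
  carrier := {ξ₀ | ∃ (ξ : ℕ → Vec η) (u : ℕ → Vec m), ξ 0 = ξ₀ ∧
    (∀ t, ξ (t + 1) = A *ᵥ ξ t + B *ᵥ u t) ∧ Tendsto ξ atTop (𝓝 0)}
  zero_mem' := ⟨0, 0, rfl, fun t => by simp, tendsto_const_nhds⟩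
  add_mem' := by
    rintro _ _ ⟨ξ, u, rfl, hξ, hξt⟩ ⟨ξ', u', rfl, hξ', hξt'⟩
    refine ⟨ξ + ξ', u + u', rfl, fun t => ?_, by
      simpa only [add_zero] using! hξt.add hξt'⟩
    simp only [Pi.add_apply, hξ, hξ', Matrix.mulVec_add]; abel
  smul_mem' := by
    rintro c _ ⟨ξ, u, rfl, hξ, hξt⟩
    refine ⟨c • ξ, c • u, rfl, fun t => ?_, by
      simpa only [smul_zero] using! hξt.const_smul c⟩
    simp only [Pi.smul_apply, hξ, Matrix.mulVec_smul, smul_add]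

/-- The image under `Ψ` of a stabilized nonlinear trajectory tends to `Ψ 0 = 0`, and such images
start from a spanning set. -/
lemma IsKLE.nullControllable_eq_top (hK : IsKLE f h Ψ A B C) (hΨ : Continuous Ψ)
    (hΨ0 : Ψ 0 = 0) (hs : Stabilizable f) : nullControllable A B = ⊤ := by
  rw [eq_top_iff, ← hK.span_range, Submodule.span_le]
  rintro _ ⟨x₀, rfl⟩
  obtain ⟨x, u, rfl, hx, hxt⟩ := hs x₀
  refine ⟨fun t => Ψ (x t), u, rfl, fun t => by simp only [hx t, hK.2.1], ?_⟩
  simpa [hΨ0, Function.comp_def] using (hΨ.tendsto 0).comp hxt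

end KLE

/-! ### Finite cost from asymptotic null controllability -/

section FiniteCost

lemma qf_le_mul_norm_sq {ι : Type} [Fintype ι] (X : Matrix ι ι ℝ) (v : ι → ℝ) :
    qf X v ≤ (∑ i, ∑ j, |X i j|) * ‖v‖ ^ 2 := by
  simp only [qf, dotProduct, Matrix.mulVec, Finset.mul_sum, Finset.sum_mul]
  refine Finset.sum_le_sum fun i _ => Finset.sum_le_sum fun j _ => ?_
  calc v i * (X i j * v j) ≤ |v i * (X i j * v j)| := le_abs_self _
    _ = |X i j| * (|v i| * |v j|) := by rw [abs_mul, abs_mul]; ring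
    _ ≤ |X i j| * (‖v‖ * ‖v‖) := by
        gcongr
        · exact norm_le_pi_norm v i
        · exact norm_le_pi_norm v j
    _ = _ := by ring

variable {m η : ℕ} {A : Matrix (Fin η) (Fin η) ℝ} {B : Matrix (Fin η) (Fin m) ℝ}

/-- If every state can be driven to the origin, then every state admits an input of finite
quadratic cost: drive a basis close to the origin in `N` steps, combine linearly, repeat. -/
lemma exists_finite_cost (hn : nullControllable A B = ⊤) {G : Matrix (Fin η) (Fin η) ℝ}
    {R : Matrix (Fin m) (Fin m) ℝ} (hG : G.PosSemidef) (hR : R.PosSemidef) (ξ₀ : Vec η) :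
    ∃ (ξ : ℕ → Vec η) (u : ℕ → Vec m) (c : ℝ), ξ 0 = ξ₀ ∧
      (∀ t, ξ (t + 1) = A *ᵥ ξ t + B *ᵥ u t) ∧
      ∀ N, ∑ t ∈ Finset.range N, (qf G (ξ t) + qf R (u t)) ≤ c := by
  have hmem : ∀ i : Fin η, (Pi.single i 1 : Vec η) ∈ nullControllable A B := fun i => by
    rw [hn]; exact Submodule.mem_top
  choose e w he0 he het using hmem
  let Φ : ℕ → Matrix (Fin η) (Fin η) ℝ := fun t => Matrix.of fun i j => e j t i
  let U : ℕ → Matrix (Fin m) (Fin η) ℝ := fun t => Matrix.of fun i j => w j t i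
  have hΦ0 : Φ 0 = 1 := by
    ext i j
    simp [Φ, he0, Matrix.one_apply, Pi.single_apply]
  have hΦs : ∀ t, Φ (t + 1) = A * Φ t + B * U t := fun t => by
    ext i j
    have := congrFun (he j t) i
    simpa [Φ, U, Matrix.mul_apply, Matrix.mulVec, dotProduct] using this
  -- A row of `η` such entries has absolute sum at most `1 / 2`, so `Φ N` halves the supremum norm.
  -- `N ≥ 1` is needed for the division of time into blocks.
  obtain ⟨N, hN1, hN⟩ : ∃ N ≥ 1, ∀ i j, |Φ N i j| ≤ 1 / (2 * (η + 1)) := by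
    have : ∀ᶠ N in atTop, ∀ i j, |Φ N i j| ≤ 1 / (2 * (η + 1)) := by
      refine eventually_all.2 fun i => eventually_all.2 fun j => ?_
      have := (tendsto_pi_nhds.1 (het j) i).abs
      simp only [Pi.zero_apply, abs_zero] at this
      exact this.eventually_le_const (by positivity)
    obtain ⟨N, h1, h2⟩ := (this.and (eventually_ge_atTop 1)).exists
    exact ⟨N, h2, h1⟩
  have hcontr : ∀ v, ‖Φ N *ᵥ v‖ ≤ 1 / 2 * ‖v‖ := fun v => by
    refine (pi_norm_le_iff_of_nonneg (by positivity)).2 fun i => ?_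
    calc ‖∑ j, Φ N i j * v j‖ ≤ ∑ j, ‖Φ N i j * v j‖ := norm_sum_le _ _
      _ ≤ ∑ _j : Fin η, 1 / (2 * (η + 1)) * ‖v‖ := by
          refine Finset.sum_le_sum fun j _ => ?_
          rw [norm_mul]
          exact mul_le_mul (hN i j) (norm_le_pi_norm v j) (norm_nonneg _) (by positivity)
      _ = η / (η + 1) * (1 / 2 * ‖v‖) := by simp; field_simp
      _ ≤ 1 * (1 / 2 * ‖v‖) := by
          gcongr
          rw [div_le_one (by positivity)]; linarith
      _ = _ := one_mul _
  let v : ℕ → Vec η := fun k => Φ N ^ k *ᵥ ξ₀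
  have hvs : ∀ k, v (k + 1) = Φ N *ᵥ v k := fun k => by
    simp only [v, pow_succ', Matrix.mulVec_mulVec]
  have hvn : ∀ k, ‖v k‖ ^ 2 ≤ ‖ξ₀‖ ^ 2 * (1 / 4) ^ k := fun k => by
    induction k with
    | zero => simp [v]
    | succ k ih =>
      have h1 := hcontr (v k)
      rw [← hvs] at h1
      calc ‖v (k + 1)‖ ^ 2 ≤ (1 / 2 * ‖v k‖) ^ 2 := by gcongr
        _ = ‖v k‖ ^ 2 * (1 / 4) := by ring
        _ ≤ ‖ξ₀‖ ^ 2 * (1 / 4) ^ k * (1 / 4) := by gcongr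
        _ = _ := by ring
  let s : ℕ → Vec η → ℝ := fun r x => qf G (Φ r *ᵥ x) + qf R (U r *ᵥ x)
  have hs0 : ∀ r x, 0 ≤ s r x := fun r x => add_nonneg (hG.qf_nonneg _) (hR.qf_nonneg _)
  obtain ⟨M, hM0, hM⟩ : ∃ M : ℝ, 0 ≤ M ∧ ∀ x, ∑ r ∈ Finset.range N, s r x ≤ M * ‖x‖ ^ 2 := by
    refine ⟨∑ r ∈ Finset.range N,
      (∑ i, ∑ j, |((Φ r)ᵀ * G * Φ r + (U r)ᵀ * R * U r) i j|), by positivity, fun x => ?_⟩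
    rw [Finset.sum_mul]
    refine Finset.sum_le_sum fun r _ => le_trans (le_of_eq ?_) (qf_le_mul_norm_sq _ x)
    rw [qf_add, qf_conj, qf_conj]
  -- Block `k` costs at most `M * ‖v k‖ ^ 2`, and the squared norms decay like `(1 / 4) ^ k`; the
  -- geometric series sums to `4 / 3`.
  refine ⟨fun t => Φ (t % N) *ᵥ v (t / N), fun t => U (t % N) *ᵥ v (t / N),
    M * ‖ξ₀‖ ^ 2 * (4 / 3), by simp [v, hΦ0], fun t => ?_, fun K => ?_⟩
  · have h1 : Φ (t % N + 1) *ᵥ v (t / N) =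
        A *ᵥ (Φ (t % N) *ᵥ v (t / N)) + B *ᵥ (U (t % N) *ᵥ v (t / N)) := by
      rw [hΦs, Matrix.add_mulVec, ← Matrix.mulVec_mulVec, ← Matrix.mulVec_mulVec]
    rw [← h1]
    change Φ ((t + 1) % N) *ᵥ v ((t + 1) / N) = _
    have hlt := Nat.mod_lt t hN1
    have hdm := Nat.div_add_mod t N
    rcases Nat.lt_or_ge (t % N + 1) N with hr | hr
    · have h2 : (t + 1) % N = t % N + 1 := by
        rw [← hdm, add_assoc, Nat.mul_add_mod, Nat.mod_eq_of_lt hr, Nat.mul_add_mod,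
          Nat.mod_eq_of_lt hlt]
      have h3 : (t + 1) / N = t / N := by
        conv_lhs => rw [← hdm, add_assoc, Nat.mul_add_div hN1, Nat.div_eq_of_lt hr, add_zero]
      rw [h2, h3]
    · have hr' : t % N + 1 = N := by omega
      have h4 : t + 1 = N * (t / N + 1) := by rw [mul_add, mul_one]; omega
      rw [hr', ← hvs, h4, Nat.mul_mod_right, Nat.mul_div_cancel_left _ hN1, hΦ0, Matrix.one_mulVec]
  · have hblock : ∀ K, ∑ t ∈ Finset.range (N * K), s (t % N) (v (t / N)) ≤
        M * ‖ξ₀‖ ^ 2 * (4 / 3 * (1 - (1 / 4) ^ K)) := fun K => by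
      induction K with
      | zero => simp
      | succ K ih =>
        have h5 : ∑ r ∈ Finset.range N, s ((N * K + r) % N) (v ((N * K + r) / N)) =
            ∑ r ∈ Finset.range N, s r (v K) := by
          refine Finset.sum_congr rfl fun r hr => ?_
          have hr := Finset.mem_range.1 hr
          rw [Nat.mul_add_mod, Nat.mod_eq_of_lt hr, Nat.mul_add_div hN1, Nat.div_eq_of_lt hr,
            add_zero]
        rw [mul_add, mul_one, Finset.sum_range_add, h5]
        have h6 := (hM (v K)).trans (mul_le_mul_of_nonneg_left (hvn K) hM0)
        rw [pow_succ (1 / 4 : ℝ)]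
        linarith
    calc _ ≤ ∑ t ∈ Finset.range (N * K), s (t % N) (v (t / N)) :=
          Finset.sum_le_sum_of_subset_of_nonneg
            (Finset.range_subset_range.2 (Nat.le_mul_of_pos_left K hN1)) fun t _ _ => hs0 _ _
      _ ≤ _ := hblock K
      _ ≤ M * ‖ξ₀‖ ^ 2 * (4 / 3) := by
          gcongr
          have : (0 : ℝ) ≤ (1 / 4) ^ K := by positivity
          linarith

end FiniteCost

/-! ### The nonminimal state as a linear function of initial state and input -/

section Trajectories

variable {m p ℓ η : ℕ} {A : Matrix (Fin η) (Fin η) ℝ} {B : Matrix (Fin η) (Fin m) ℝ}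
  {C : Matrix (Fin p) (Fin η) ℝ} {Γ : Matrix (Fin η) (Fin ℓ × Fin p) ℝ}

/-- The state of `ξ_{t+1} = A ξ_t + B u_t` as a function of the initial state and the input. -/
def linState (A : Matrix (Fin η) (Fin η) ℝ) (B : Matrix (Fin η) (Fin m) ℝ) (ξ₀ : Vec η)
    (u : ℕ → Vec m) : ℕ → Vec η
  | 0 => ξ₀
  | t + 1 => A *ᵥ linState A B ξ₀ u t + B *ᵥ u t

lemma linState_isLinTrajectory (ξ₀ : Vec η) (u : ℕ → Vec m) :
    IsLinTrajectory A B C (linState A B ξ₀ u) u (fun t => C *ᵥ linState A B ξ₀ u t) :=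
  ⟨fun _ => rfl, fun _ => rfl⟩

lemma linState_eq {ξ : ℕ → Vec η} {u u' : ℕ → Vec m} {N : ℕ}
    (hξ : ∀ t < N, ξ (t + 1) = A *ᵥ ξ t + B *ᵥ u t) (hu : ∀ t < N, u' t = u t) {t : ℕ}
    (ht : t ≤ N) : linState A B (ξ 0) u' t = ξ t := by
  induction t with
  | zero => rfl
  | succ t ih => rw [linState, ih (by omega), hu t (by omega), hξ t (by omega)]

lemma linState_add (ξ ξ' : Vec η) (u u' : ℕ → Vec m) (t : ℕ) :
    linState A B (ξ + ξ') (u + u') t = linState A B ξ u t + linState A B ξ' u' t := by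
  induction t with
  | zero => rfl
  | succ t ih => simp only [linState, ih, Pi.add_apply, Matrix.mulVec_add]; abel

lemma linState_smul (c : ℝ) (ξ : Vec η) (u : ℕ → Vec m) (t : ℕ) :
    linState A B (c • ξ) (c • u) t = c • linState A B ξ u t := by
  induction t with
  | zero => rfl
  | succ t ih => simp only [linState, ih, Pi.smul_apply, Matrix.mulVec_smul, smul_add]

lemma window_congr {d : ℕ} {w w' : ℕ → Vec d} {s s' k : ℕ} (h : ∀ i < k, w (s + i) = w' (s' + i)) :
    window w s k = window w' s' k :=
  funext fun r => congrFun (h r.1 r.1.2) r.2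

lemma zState_congr {u u' : ℕ → Vec m} {y y' : ℕ → Vec p} {s s' : ℕ}
    (hu : ∀ i < ℓ, u (s + i) = u' (s' + i)) (hy : ∀ i < ℓ, y (s + i) = y' (s' + i)) :
    zState Γ u y s = zState Γ u' y' s' := by
  rw [zState, zState, window_congr hu, window_congr hy]

lemma tendsto_zState {u : ℕ → Vec m} {y : ℕ → Vec p} (hu : Tendsto u atTop (𝓝 0))
    (hy : Tendsto y atTop (𝓝 0)) : Tendsto (zState Γ u y) atTop (𝓝 0) := by
  have hw : ∀ {d : ℕ} {w : ℕ → Vec d}, Tendsto w atTop (𝓝 0) →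
      Tendsto (fun s => window w s ℓ) atTop (𝓝 0) := by
    intro d w h
    refine tendsto_pi_nhds.2 fun r => ?_
    exact tendsto_pi_nhds.1 ((tendsto_add_atTop_iff_nat (r.1 : ℕ)).2 h) r.2
  have hΓ : Continuous fun v : Fin ℓ × Fin p → ℝ => Γ *ᵥ v := by fun_prop
  have h2 := (hΓ.tendsto 0).comp (hw hy)
  rw [Matrix.mulVec_zero] at h2
  refine tendsto_pi_nhds.2 fun r => ?_
  rcases r with r | r
  · exact tendsto_pi_nhds.1 (hw hu) r
  · exact tendsto_pi_nhds.1 h2 r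

/-- The nonminimal state at time `s + ℓ` is linear in the initial state and the input. -/
def zMap (A : Matrix (Fin η) (Fin η) ℝ) (B : Matrix (Fin η) (Fin m) ℝ)
    (C : Matrix (Fin p) (Fin η) ℝ) (Γ : Matrix (Fin η) (Fin ℓ × Fin p) ℝ) (s : ℕ) :
    (Vec η × (ℕ → Vec m)) →ₗ[ℝ] (ZIdx m ℓ η → ℝ) where
  toFun q := zState Γ q.2 (fun t => C *ᵥ linState A B q.1 q.2 t) s
  map_add' q q' := by
    ext r
    rcases r with r | r
    · rfl
    · simp only [zState, Sum.elim_inr, Pi.add_apply, Prod.fst_add, Prod.snd_add, linState_add,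
        Matrix.mulVec_add]
      rw [← Pi.add_apply, ← Matrix.mulVec_add]
      rfl
  map_smul' c q := by
    ext r
    rcases r with r | r
    · rfl
    · simp only [zState, Sum.elim_inr, Pi.smul_apply, Prod.smul_fst, Prod.smul_snd, linState_smul,
        Matrix.mulVec_smul, RingHom.id_apply]
      rw [← Pi.smul_apply, ← Matrix.mulVec_smul]
      rfl

/-- Time invariance: the trajectory may be restarted at time `s`. -/
lemma IsLinTrajectory.zState_eq_zMap {ξ : ℕ → Vec η} {u : ℕ → Vec m} {y : ℕ → Vec p}
    (hξ : IsLinTrajectory A B C ξ u y) (s k : ℕ) :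
    zState Γ u y (s + k) = zMap A B C Γ k (ξ s, fun t => u (s + t)) := by
  have h1 : ∀ t, linState A B (ξ s) (fun t => u (s + t)) t = ξ (s + t) := fun t =>
    linState_eq (ξ := fun t => ξ (s + t)) (N := t) (fun t _ => hξ.1 (s + t)) (fun _ _ => rfl) le_rfl
  refine zState_congr (fun i _ => by rw [add_assoc]) fun i _ => ?_
  simp only [h1, hξ.2, add_assoc]

/-- Every nonminimal state together with any later input occurs along a linear trajectory. -/
lemma exists_isLinTrajectory_of_surjective (hs : Function.Surjective (zMap A B C Γ 0))
    (z : ZIdx m ℓ η → ℝ) (v : ℕ → Vec m) :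
    ∃ (ξ : ℕ → Vec η) (u : ℕ → Vec m) (y : ℕ → Vec p), IsLinTrajectory A B C ξ u y ∧
      zState Γ u y 0 = z ∧ ∀ s, u (s + ℓ) = v s := by
  obtain ⟨⟨ξ₀, w⟩, rfl⟩ := hs z
  have hlt : ∀ t < ℓ, (fun t => if t < ℓ then w t else v (t - ℓ)) t = w t := fun t ht => if_pos ht
  refine ⟨_, fun t => if t < ℓ then w t else v (t - ℓ), _,
    linState_isLinTrajectory ξ₀ _, zState_congr (fun i hi => ?_) fun i hi => ?_, fun s => ?_⟩
  · simpa using hlt i hi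
  · simp only [zero_add]
    rw [← linState_eq (ξ := linState A B ξ₀ w) (N := ℓ) (fun t _ => rfl) hlt hi.le]
    rfl
  · simp

lemma exists_comp_eq_of_ker_le {V W U : Type} [AddCommGroup V] [Module ℝ V] [AddCommGroup W]
    [Module ℝ W] [AddCommGroup U] [Module ℝ U] (α : V →ₗ[ℝ] W) (β : V →ₗ[ℝ] U)
    (hα : Function.Surjective α) (h : LinearMap.ker α ≤ LinearMap.ker β) :
    ∃ γ : W →ₗ[ℝ] U, ∀ v, γ (α v) = β v := by
  obtain ⟨σ, hσ⟩ := α.exists_rightInverse_of_surjective (LinearMap.range_eq_top.2 hα)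
  refine ⟨β ∘ₗ σ, fun v => ?_⟩
  have h1 : σ (α v) - v ∈ LinearMap.ker α := by
    rw [LinearMap.mem_ker, map_sub, sub_eq_zero]
    exact LinearMap.congr_fun hσ (α v)
  have h2 := h h1
  rwa [LinearMap.mem_ker, map_sub, sub_eq_zero] at h2

/-- If the nonminimal state takes all values, then it determines the initial state. -/
lemma ker_zMap (hs : Function.Surjective (zMap A B C Γ 0)) {q : Vec η × (ℕ → Vec m)}
    (hq : zMap A B C Γ 0 q = 0) : q.1 = 0 ∧ ∀ t < ℓ, q.2 t = 0 := by
  -- With zero input the output window is the observability matrix applied to the initial state.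
  -- This is used for the given `q` and for preimages of `(0, e)`.
  have hu : ∀ {q : Vec η × (ℕ → Vec m)}, (∀ r, zMap A B C Γ 0 q (Sum.inl r) = 0) →
      (∀ t < ℓ, q.2 t = 0) ∧
        (fun i => zMap A B C Γ 0 q (Sum.inr i)) = (Γ * obsMatrix A C ℓ) *ᵥ q.1 := by
    intro q hq
    have h1 : ∀ t < ℓ, q.2 t = 0 := fun t ht => funext fun i => by
      have := hq (⟨t, ht⟩, i)
      change q.2 (0 + t) i = 0 at this
      rwa [zero_add] at this
    refine ⟨h1, ?_⟩
    rw [← Matrix.mulVec_mulVec]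
    have h2 : window (fun t => C *ᵥ linState A B q.1 q.2 t) 0 ℓ = obsMatrix A C ℓ *ᵥ q.1 := by
      ext r
      rw [obsMatrix_mulVec, window]
      have h3 : ∀ t ≤ ℓ, linState A B q.1 q.2 t = A ^ t *ᵥ q.1 := fun t ht => by
        induction t with
        | zero => simp [linState]
        | succ t ih =>
          rw [linState, ih (by omega), h1 t (by omega), pow_succ', Matrix.mulVec_zero, add_zero,
            Matrix.mulVec_mulVec]
      simp only [zero_add]
      rw [h3 _ r.1.2.le]
    rw [← h2]; rfl
  obtain ⟨h1, h2⟩ := hu (q := q) fun r => by rw [hq]; rfl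
  refine ⟨?_, h1⟩
  -- The matrix is square, and surjectivity of `zMap` onto the points `(0, e)` makes it onto, hence
  -- injective.
  have hrank : (Γ * obsMatrix A C ℓ).rank = Fintype.card (Fin η) := by
    have : LinearMap.range (Γ * obsMatrix A C ℓ).mulVecLin = ⊤ := by
      refine LinearMap.range_eq_top.2 fun e => ?_
      obtain ⟨q', hq'⟩ := hs (Sum.elim 0 e)
      refine ⟨q'.1, ?_⟩
      rw [Matrix.mulVecLin_apply, ← (hu (q := q') fun r => by rw [hq']; rfl).2, hq']
      rfl
    rw [Matrix.rank, this, finrank_top, Module.finrank_fintype_fun_eq_card]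
  refine mulVec_eq_zero_of_rank_eq_card hrank ?_
  rw [← h2, hq]; rfl

/-- By `ker_zMap`, vanishing `z` and current input force a zero initial state and zero inputs up to
time `ℓ`, hence a zero next `z`. The next `z` thus factors linearly through the surjection onto
(`z`, current input); the blocks of the factor are the realization. -/
lemma exists_isZRealization (hs : Function.Surjective (zMap A B C Γ 0))
    {T : Matrix (Fin η) (ZIdx m ℓ η) ℝ} (hT : IsStateMap A B C Γ T) :
    ∃ Ab Bb Cb, IsZRealization A B C Γ Ab Bb Cb := by
  let ev : (Vec η × (ℕ → Vec m)) →ₗ[ℝ] Vec m := (LinearMap.proj ℓ) ∘ₗ LinearMap.snd ℝ _ _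
  have hev : ∀ q, ev q = q.2 ℓ := fun q => rfl
  obtain ⟨γ, hγ⟩ := exists_comp_eq_of_ker_le ((zMap A B C Γ 0).prod ev) (zMap A B C Γ 1)
    (fun ⟨z, w⟩ => by
      obtain ⟨ξ, u, y, hξ, hz, hu⟩ := exists_isLinTrajectory_of_surjective hs z fun _ => w
      refine ⟨(ξ 0, u), Prod.ext ?_ ?_⟩
      · have := hξ.zState_eq_zMap (Γ := Γ) 0 0
        simp only [zero_add] at this
        exact this.symm.trans hz
      · exact (by simpa using hu 0 : u ℓ = w))
    (fun q hq => by
      obtain ⟨h1, h2⟩ := Prod.ext_iff.1 (LinearMap.mem_ker.1 hq)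
      obtain ⟨h3, h4⟩ := ker_zMap hs h1
      replace h2 : q.2 ℓ = 0 := h2
      have h5 : ∀ t ≤ ℓ, q.2 t = 0 := fun t ht => by
        rcases ht.lt_or_eq with ht | rfl
        · exact h4 t ht
        · exact h2
      have h6 : ∀ t ≤ ℓ, linState A B q.1 q.2 t = 0 := fun t ht => by
        rw [h3]
        exact linState_eq (ξ := fun _ => 0) (u := fun _ => 0) (N := ℓ)
          (fun t _ => by simp) (fun t ht => h5 t ht.le) ht
      refine LinearMap.mem_ker.2 ((zState_congr (u' := fun _ => 0) (y' := fun _ => 0) (s' := 0)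
        (fun i hi => h5 _ (by omega)) fun i hi => ?_).trans ?_)
      · rw [h6 _ (by omega), Matrix.mulVec_zero]
      · ext r
        rcases r with r | r
        · rfl
        · change (Γ *ᵥ 0) r = 0
          rw [Matrix.mulVec_zero]; rfl)
  refine ⟨LinearMap.toMatrix' (γ ∘ₗ LinearMap.inl ℝ _ _),
    LinearMap.toMatrix' (γ ∘ₗ LinearMap.inr ℝ _ _), C * T, fun ξ u y hξ s => ⟨?_, ?_⟩⟩
  · rw [hξ.zState_eq_zMap s 1, ← hγ, LinearMap.toMatrix'_mulVec, LinearMap.toMatrix'_mulVec,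
      LinearMap.comp_apply, LinearMap.comp_apply, ← map_add, LinearMap.inl_apply,
      LinearMap.inr_apply, Prod.mk_add_mk, add_zero, zero_add]
    congr 1
    refine Prod.ext ?_ ?_
    · exact (hξ.zState_eq_zMap s 0).symm
    · rfl
  · rw [hξ.2, hT.2 ξ u y hξ s, Matrix.mulVec_mulVec]

end Trajectories

/-! ### Detectability of both realizations and their intertwining -/

section Detectability

variable {m p ℓ η : ℕ} {A : Matrix (Fin η) (Fin η) ℝ} {B : Matrix (Fin η) (Fin m) ℝ}
  {C : Matrix (Fin p) (Fin η) ℝ} {Γ : Matrix (Fin η) (Fin ℓ × Fin p) ℝ}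
  {Q : Matrix (Fin p) (Fin p) ℝ} {R : Matrix (Fin m) (Fin m) ℝ}

lemma tendsto_zero_of_stage {p m : ℕ} {Q : Matrix (Fin p) (Fin p) ℝ}
    {R : Matrix (Fin m) (Fin m) ℝ} (hQ : Q.PosDef) (hR : R.PosDef) {y : ℕ → Vec p}
    {u : ℕ → Vec m} (h : Tendsto (fun t => qf Q (y t) + qf R (u t)) atTop (𝓝 0)) :
    Tendsto y atTop (𝓝 0) ∧ Tendsto u atTop (𝓝 0) := by
  refine ⟨tendsto_zero_of_qf hQ ?_, tendsto_zero_of_qf hR ?_⟩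
  · exact squeeze_zero (fun t => hQ.posSemidef.qf_nonneg _)
      (fun t => le_add_of_nonneg_right (hR.posSemidef.qf_nonneg _)) h
  · exact squeeze_zero (fun t => hR.posSemidef.qf_nonneg _)
      (fun t => le_add_of_nonneg_left (hQ.posSemidef.qf_nonneg _)) h

/-- The state is a fixed linear function of a finite window of inputs and outputs. -/
lemma IsStateMap.tendsto_zero {T : Matrix (Fin η) (ZIdx m ℓ η) ℝ} (hT : IsStateMap A B C Γ T)
    {ξ : ℕ → Vec η} {u : ℕ → Vec m} {y : ℕ → Vec p} (hξ : IsLinTrajectory A B C ξ u y)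
    (hu : Tendsto u atTop (𝓝 0)) (hy : Tendsto y atTop (𝓝 0)) : Tendsto ξ atTop (𝓝 0) := by
  rw [← tendsto_add_atTop_iff_nat ℓ]
  simp only [hT.2 ξ u y hξ]
  have hc : Continuous fun z : ZIdx m ℓ η → ℝ => T *ᵥ z := by fun_prop
  simpa [Function.comp_def] using (hc.tendsto 0).comp (tendsto_zState (Γ := Γ) hu hy)

lemma IsStateMap.stageDetectable {T : Matrix (Fin η) (ZIdx m ℓ η) ℝ}
    (hT : IsStateMap A B C Γ T) (hQ : Q.PosDef) (hR : R.PosDef) :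
    StageDetectable A B (Cᵀ * Q * C) R := by
  intro z u hz h
  simp only [qf_conj] at h
  obtain ⟨hy, hu⟩ := tendsto_zero_of_stage hQ hR h
  exact hT.tendsto_zero ⟨hz, fun _ => rfl⟩ hu hy

/-- Surjectivity of `zMap` makes every trajectory of the realization a sequence of genuine
input-output windows, which vanish together with inputs and outputs. -/
lemma IsZRealization.stageDetectable {Ab : Matrix (ZIdx m ℓ η) (ZIdx m ℓ η) ℝ}
    {Bb : Matrix (ZIdx m ℓ η) (Fin m) ℝ} {Cb : Matrix (Fin p) (ZIdx m ℓ η) ℝ}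
    (hr : IsZRealization A B C Γ Ab Bb Cb) (hs : Function.Surjective (zMap A B C Γ 0))
    (hQ : Q.PosDef) (hR : R.PosDef) : StageDetectable Ab Bb (Cbᵀ * Q * Cb) R := by
  intro z v hz h
  simp only [qf_conj] at h
  obtain ⟨hy, hv⟩ := tendsto_zero_of_stage hQ hR h
  obtain ⟨ξ, u, y, hξ, hz0, hu⟩ := exists_isLinTrajectory_of_surjective hs (z 0) v
  have hzs : ∀ s, zState Γ u y s = z s := fun s => by
    induction s with
    | zero => exact hz0
    | succ s ih => rw [(hr ξ u y hξ s).1, ih, hu, hz]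
  rw [← show zState Γ u y = z from funext hzs]
  refine tendsto_zState ((tendsto_add_atTop_iff_nat ℓ).1 ?_) ((tendsto_add_atTop_iff_nat ℓ).1 ?_)
  · simpa only [hu] using hv
  · simpa only [fun s => (hr ξ u y hξ s).2, hzs] using hy

lemma matrix_eq_of_mulVec {α β : Type} [Fintype β] [DecidableEq β] {M N : Matrix α β ℝ}
    (h : ∀ v, M *ᵥ v = N *ᵥ v) : M = N := by
  ext i j
  simpa using congrFun (h (Pi.single j 1)) i

/-- The state map intertwines the two realizations. -/
lemma IsStateMap.intertwines {T : Matrix (Fin η) (ZIdx m ℓ η) ℝ} (hT : IsStateMap A B C Γ T)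
    {Ab : Matrix (ZIdx m ℓ η) (ZIdx m ℓ η) ℝ} {Bb : Matrix (ZIdx m ℓ η) (Fin m) ℝ}
    {Cb : Matrix (Fin p) (ZIdx m ℓ η) ℝ} (hr : IsZRealization A B C Γ Ab Bb Cb)
    (hs : Function.Surjective (zMap A B C Γ 0)) :
    T * Ab = A * T ∧ T * Bb = B ∧ Cb = C * T := by
  -- Every pair `(z, v)` occurs along a trajectory, so identities along trajectories become matrix
  -- identities.
  have key : ∀ z v, T *ᵥ (Ab *ᵥ z + Bb *ᵥ v) = A *ᵥ (T *ᵥ z) + B *ᵥ v ∧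
      Cb *ᵥ z = C *ᵥ (T *ᵥ z) := fun z v => by
    obtain ⟨ξ, u, y, hξ, hz0, hu⟩ := exists_isLinTrajectory_of_surjective hs z fun _ => v
    obtain ⟨h1, h2⟩ := hr ξ u y hξ 0
    rw [hz0, hu] at h1
    rw [hz0] at h2
    have h3 := hT.2 ξ u y hξ 0
    rw [hz0] at h3
    refine ⟨?_, ?_⟩
    · rw [← h1, ← hT.2 ξ u y hξ, ← h3, add_right_comm, hξ.1, hu]
    · rw [← h2, ← h3, hξ.2]
  refine ⟨matrix_eq_of_mulVec fun z => ?_, matrix_eq_of_mulVec fun v => ?_,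
    matrix_eq_of_mulVec fun z => ?_⟩
  · simpa using (key z 0).1
  · simpa using (key 0 v).1
  · simpa using (key z 0).2

end Detectability

/-! ### Riccati equation, stabilization and optimality on the embedding -/

section MinimalSystem

variable {n m p ℓ η : ℕ} {f : Vec n → Vec m → Vec n} {h : Vec n → Vec p} {Ψ : Vec n → Vec η}
  {A : Matrix (Fin η) (Fin η) ℝ} {B : Matrix (Fin η) (Fin m) ℝ} {C : Matrix (Fin p) (Fin η) ℝ}
  {Γ : Matrix (Fin η) (Fin ℓ × Fin p) ℝ} {T : Matrix (Fin η) (ZIdx m ℓ η) ℝ}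
  {Q : Matrix (Fin p) (Fin p) ℝ} {R : Matrix (Fin m) (Fin m) ℝ} {P : Matrix (Fin η) (Fin η) ℝ}

lemma isRiccatiSolution_iff (hR : R.PosDef) : IsRiccatiSolution A B C Q R P ↔
    P.PosDef ∧ P = policyMap A B (Cᵀ * Q * C) R (greedyGain A B R P) P := by
  refine and_congr_right fun hP => ?_
  rw [policyMap_greedy hR hP.posSemidef, eq_comm (a := P), ← sub_eq_zero (b := P)]
  refine Eq.congr_left ?_
  abel

/-- Observability makes the value matrix of any feedback positive definite. -/
lemma Observable.posDef (hO : Observable A C) (hQ : Q.PosDef) (hR : R.PosDef)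
    (hP : P.PosSemidef) {K : Matrix (Fin m) (Fin η) ℝ}
    (hPe : P = policyMap A B (Cᵀ * Q * C) R K P) : P.PosDef := by
  refine posDef_iff_qf.2 ⟨hP.isSymm, fun z hz => (hP.qf_nonneg z).lt_of_ne' fun h0 => hz ?_⟩
  -- Zero value forces zero output and zero input, so the null states of `P` are carried by `A` into
  -- each other with no output.
  have step : ∀ z, qf P z = 0 → C *ᵥ z = 0 ∧ qf P (A *ᵥ z) = 0 := fun z h0 => by
    have h1 : qf P z = _ := congrArg (fun X => qf X z) hPe
    rw [qf_policyMap, qf_conj, h0] at h1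
    have h2 := hQ.posSemidef.qf_nonneg (C *ᵥ z)
    have h3 := hR.posSemidef.qf_nonneg (-(K *ᵥ z))
    have h4 := hP.qf_nonneg (A *ᵥ z + B *ᵥ -(K *ᵥ z))
    have h5 : -(K *ᵥ z) = 0 := by
      by_contra hne
      linarith [(posDef_iff_qf.1 hR).2 _ hne]
    refine ⟨?_, ?_⟩
    · by_contra hne
      linarith [(posDef_iff_qf.1 hQ).2 _ hne]
    · rw [h5] at h1 h3 h4
      rw [Matrix.mulVec_zero, add_zero] at h1 h4
      linarith
  have hall : ∀ k : ℕ, qf P (A ^ k *ᵥ z) = 0 := fun k => by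
    induction k with
    | zero => simpa using h0
    | succ k ih =>
      rw [pow_succ', ← Matrix.mulVec_mulVec]
      exact (step _ ih).2
  exact hO.eq_zero fun k => (step _ (hall k)).1

/-- The Riccati equation of an observable embedding of a stabilizable system is uniquely
solvable. -/
lemma exists_unique_riccati (hn : nullControllable A B = ⊤) (hO : Observable A C)
    (hT : IsStateMap A B C Γ T) (hQ : Q.PosDef) (hR : R.PosDef) :
    ∃ P, IsRiccatiSolution A B C Q R P ∧ ∀ P', IsRiccatiSolution A B C Q R P' → P' = P := by
  have hG := posSemidef_conj hQ.posSemidef C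
  obtain ⟨P, hP, hPe⟩ := exists_riccati (A := A) (B := B) hG hR
    fun ξ₀ => exists_finite_cost hn hG hR.posSemidef ξ₀
  refine ⟨P, (isRiccatiSolution_iff hR).2 ⟨hO.posDef hQ hR hP hPe, hPe⟩, fun P' hP' => ?_⟩
  obtain ⟨hP', hPe'⟩ := (isRiccatiSolution_iff hR).1 hP'
  exact (hT.stageDetectable hQ hR).riccati_unique hG hR hP'.posSemidef hP hPe' hPe

lemma IsClosedLoop.optimal_step (hK : IsKLE f h Ψ A B C) (hT : IsStateMap A B C Γ T)
    {K : Matrix (Fin m) (Fin η) ℝ} {x : ℕ → Vec n} {u : ℕ → Vec m} {y : ℕ → Vec p}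
    (hc : IsClosedLoop f h Γ (K * T) x u y) (s : ℕ) :
    u (s + ℓ) = -(K *ᵥ Ψ (x (s + ℓ))) ∧
      Ψ (x (s + 1 + ℓ)) = A *ᵥ Ψ (x (s + ℓ)) + B *ᵥ u (s + ℓ) := by
  have hξ := hK.isLinTrajectory hc.1
  refine ⟨?_, ?_⟩
  · rw [hc.2, ← Matrix.mulVec_mulVec, ← hT.2 _ u y hξ s]
  · rw [add_right_comm]; exact hξ.1 (s + ℓ)

/-- From time `ℓ` on, the feedback acts as state feedback on `Ψ x`, which tends to zero; so does the
output, and nonlinear detectability returns to `x`. -/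
lemma stabilizes_lqrGain (hK : IsKLE f h Ψ A B C) (hdet : Detectable f h)
    (hT : IsStateMap A B C Γ T) (hQ : Q.PosDef) (hR : R.PosDef)
    (hP : IsRiccatiSolution A B C Q R P) : Stabilizes f h Γ (lqrGain A B R P * T) := by
  intro x u y hc
  obtain ⟨hPd, hPe⟩ := (isRiccatiSolution_iff hR).1 hP
  have hF : PowTendsto (A - B * lqrGain A B R P) :=
    (hT.stageDetectable hQ hR).powTendsto (posSemidef_conj hQ.posSemidef C) hR hPd.posSemidef
      fun z => by
        change qf (policyMap A B _ R (greedyGain A B R P) P) z ≤ _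
        rw [← hPe]
  have hξ : Tendsto (fun s => Ψ (x (s + ℓ))) atTop (𝓝 0) := by
    refine hF.tendsto_iterate fun s => ?_
    obtain ⟨h1, h2⟩ := hc.optimal_step hK hT s
    rw [h2, h1, Matrix.sub_mulVec, Matrix.mulVec_neg, ← Matrix.mulVec_mulVec, sub_eq_add_neg]
  refine hdet x u y hc.1 ((tendsto_add_atTop_iff_nat ℓ).1 ?_)
  simp only [hc.1.2, hK.2.2]
  have hcC : Continuous fun v : Vec η => C *ᵥ v := by fun_prop
  simpa [Function.comp_def] using (hcC.tendsto 0).comp hξ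

lemma sum_ofReal_stage (hQ : Q.PosDef) (hR : R.PosDef) (y : ℕ → Vec p) (u : ℕ → Vec m) (N : ℕ) :
    ∑ t ∈ Finset.range N, ENNReal.ofReal (y t ⬝ᵥ (Q *ᵥ y t) + u t ⬝ᵥ (R *ᵥ u t)) =
      ENNReal.ofReal (∑ t ∈ Finset.range N, (qf Q (y t) + qf R (u t))) :=
  (ENNReal.ofReal_sum_of_nonneg fun _ _ =>
    add_nonneg (hQ.posSemidef.qf_nonneg _) (hR.posSemidef.qf_nonneg _)).symm

lemma cost_le_of_sum_le (hQ : Q.PosDef) (hR : R.PosDef) {y : ℕ → Vec p} {u : ℕ → Vec m} {c : ℝ}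
    (hc : ∀ N, ∑ t ∈ Finset.range N, (qf Q (y t) + qf R (u t)) ≤ c) :
    cost Q R y u ≤ ENNReal.ofReal c :=
  ENNReal.tsum_le_of_sum_range_le fun N => by
    rw [sum_ofReal_stage hQ hR]
    exact ENNReal.ofReal_le_ofReal (hc N)

/-- Finite cost forces inputs and outputs, hence the state, to vanish, so the terminal term of the
telescoped Riccati inequality disappears. -/
lemma qf_riccati_le_cost (hT : IsStateMap A B C Γ T) (hQ : Q.PosDef) (hR : R.PosDef)
    (hP : IsRiccatiSolution A B C Q R P) {ξ : ℕ → Vec η} {u : ℕ → Vec m} {y : ℕ → Vec p}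
    (hξ : IsLinTrajectory A B C ξ u y) : ENNReal.ofReal (qf P (ξ 0)) ≤ cost Q R y u := by
  by_cases htop : cost Q R y u = ⊤
  · rw [htop]; exact le_top
  obtain ⟨hPd, hPe⟩ := (isRiccatiSolution_iff hR).1 hP
  have hs0 : ∀ t, 0 ≤ qf Q (y t) + qf R (u t) := fun t =>
    add_nonneg (hQ.posSemidef.qf_nonneg _) (hR.posSemidef.qf_nonneg _)
  have hst : Tendsto (fun t => qf Q (y t) + qf R (u t)) atTop (𝓝 0) := by
    have h1 := ENNReal.tendsto_atTop_zero_of_tsum_ne_top htop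
    have h2 := (ENNReal.tendsto_toReal ENNReal.zero_ne_top).comp h1
    refine h2.congr fun t => ?_
    exact ENNReal.toReal_ofReal (hs0 t)
  obtain ⟨hy, hu⟩ := tendsto_zero_of_stage hQ hR hst
  have hξt := hT.tendsto_zero hξ hu hy
  have hstep : ∀ t, qf P (ξ t) ≤ (qf Q (y t) + qf R (u t)) + qf P (ξ (t + 1)) := fun t => by
    have h1 := stage_add_qf_next (A := A) (B := B) (G := Cᵀ * Q * C) hR hPd.posSemidef (ξ t) (u t)
    rw [← hPe, qf_conj, ← hξ.1, ← hξ.2] at h1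
    linarith [(inputWeight_posDef (B := B) hR hPd.posSemidef).posSemidef.qf_nonneg
      (u t + greedyGain A B R P *ᵥ ξ t)]
  have hsum : ∀ N, qf P (ξ 0) - qf P (ξ N) ≤ (cost Q R y u).toReal := fun N => by
    have h1 := le_sum_stage hstep N
    have h2 : ENNReal.ofReal (∑ t ∈ Finset.range N, (qf Q (y t) + qf R (u t))) ≤ cost Q R y u := by
      rw [← sum_ofReal_stage hQ hR]
      exact ENNReal.sum_le_tsum _
    have h3 := (ENNReal.ofReal_le_iff_le_toReal htop).1 h2
    linarith
  have hlim : Tendsto (fun N => qf P (ξ 0) - qf P (ξ N)) atTop (𝓝 (qf P (ξ 0) - 0)) := by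
    have := ((continuous_qf P).tendsto 0).comp hξt
    rw [qf_zero_right] at this
    exact tendsto_const_nhds.sub this
  rw [sub_zero] at hlim
  exact (ENNReal.ofReal_le_iff_le_toReal htop).2 (le_of_tendsto' hlim hsum)

lemma minimizesCost_lqrGain (hK : IsKLE f h Ψ A B C) (hT : IsStateMap A B C Γ T)
    (hQ : Q.PosDef) (hR : R.PosDef) (hP : IsRiccatiSolution A B C Q R P) :
    MinimizesCost f h Q R Γ (lqrGain A B R P * T) := by
  intro x u y hc
  obtain ⟨hPd, hPe⟩ := (isRiccatiSolution_iff hR).1 hP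
  have hle : cost Q R (fun t => y (t + ℓ)) (fun t => u (t + ℓ)) ≤
      ENNReal.ofReal (qf P (Ψ (x ℓ))) := by
    refine cost_le_of_sum_le hQ hR fun N => ?_
    have h1 := sum_stage_le (X := P) (z := fun t => Ψ (x (t + ℓ)))
      (s := fun t => qf Q (y (t + ℓ)) + qf R (u (t + ℓ))) (fun t => ?_) N
    · simp only [zero_add] at h1
      linarith [hPd.posSemidef.qf_nonneg (Ψ (x (N + ℓ)))]
    · obtain ⟨h2, h3⟩ := hc.optimal_step hK hT t
      have h4 := qf_policyMap (A := A) (B := B) (G := Cᵀ * Q * C) (R := R)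
        (greedyGain A B R P) P (Ψ (x (t + ℓ)))
      rw [← hPe, show -(greedyGain A B R P *ᵥ Ψ (x (t + ℓ))) = u (t + ℓ) from h2.symm, ← h3,
        qf_conj, ← hK.2.2, ← hc.1.2] at h4
      exact h4.ge
  refine ⟨hle.trans_lt ENNReal.ofReal_lt_top, fun x' u' y' hx' h0 => hle.trans ?_⟩
  rw [← h0]
  exact qf_riccati_le_cost hT hQ hR hP (hK.isLinTrajectory hx')

end MinimalSystem

/-! ### State-action value matrices and the Bellman equation -/

section Bellman

variable {ι κ : Type} [Fintype ι] [Fintype κ] [DecidableEq ι] [DecidableEq κ]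
variable {A : Matrix ι ι ℝ} {B : Matrix ι κ ℝ} {G : Matrix ι ι ℝ} {R : Matrix κ κ ℝ}

/-- The transition matrix of the pair `(z, u)` under the feedback `u = -K z`. -/
def pairTransition (A : Matrix ι ι ℝ) (B : Matrix ι κ ℝ) (K : Matrix κ ι ℝ) :
    Matrix (ι ⊕ κ) (ι ⊕ κ) ℝ :=
  Matrix.fromRows 1 (-K) * Matrix.fromCols A B

/-- The matrix of the state-action value function with state value `X`. -/
def qMatrix (A : Matrix ι ι ℝ) (B : Matrix ι κ ℝ) (G : Matrix ι ι ℝ) (R : Matrix κ κ ℝ)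
    (X : Matrix ι ι ℝ) : Matrix (ι ⊕ κ) (ι ⊕ κ) ℝ :=
  Matrix.fromBlocks G 0 0 R + (Matrix.fromCols A B)ᵀ * X * Matrix.fromCols A B

lemma fromCols_mul_fromRows_feedback (K : Matrix κ ι ℝ) :
    Matrix.fromCols A B * Matrix.fromRows (1 : Matrix ι ι ℝ) (-K) = A - B * K := by
  rw [Matrix.fromCols_mul_fromRows, Matrix.mul_one, Matrix.mul_neg, sub_eq_add_neg]

/-- Exchanging the two factors of `pairTransition` gives `A - B * K`, so stability passes from the
closed loop to the pair. -/
lemma pairTransition_pow_succ (K : Matrix κ ι ℝ) (k : ℕ) :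
    pairTransition A B K ^ (k + 1) =
      Matrix.fromRows 1 (-K) * (A - B * K) ^ k * Matrix.fromCols A B := by
  induction k with
  | zero => simp [pairTransition]
  | succ k ih =>
    rw [pow_succ, ih, pairTransition, pow_succ (A - B * K), ← fromCols_mul_fromRows_feedback K]
    simp only [Matrix.mul_assoc]

lemma PowTendsto.pairTransition {K : Matrix κ ι ℝ} (hK : PowTendsto (A - B * K)) :
    PowTendsto (pairTransition A B K) := by
  refine (tendsto_add_atTop_iff_nat (f := fun k => KoopmanQL.pairTransition A B K ^ k) 1).1 ?_
  simp only [pairTransition_pow_succ]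
  have hc : Continuous fun M : Matrix ι ι ℝ =>
      Matrix.fromRows (1 : Matrix ι ι ℝ) (-K) * M * Matrix.fromCols A B := by fun_prop
  have := (hc.tendsto 0).comp hK
  simpa only [Matrix.mul_zero, Matrix.zero_mul] using! this

lemma qMatrix_eq (A : Matrix ι ι ℝ) (B : Matrix ι κ ℝ) (G : Matrix ι ι ℝ) (R : Matrix κ κ ℝ)
    (X : Matrix ι ι ℝ) : qMatrix A B G R X =
      Matrix.fromBlocks (G + Aᵀ * X * A) (Aᵀ * X * B) (Bᵀ * X * A) (R + Bᵀ * X * B) := by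
  rw [qMatrix, Matrix.transpose_fromCols, Matrix.fromRows_mul, Matrix.fromRows_mul_fromCols,
    Matrix.fromBlocks_add, zero_add, zero_add]

lemma qMatrix_isSymm (hG : G.IsSymm) (hR : R.IsSymm) {X : Matrix ι ι ℝ} (hX : X.IsSymm) :
    (qMatrix A B G R X).IsSymm :=
  Matrix.IsSymm.add (hG.fromBlocks (by simp) hR) (isSymm_conj hX _)

/-- Restricting the state-action form to `u = -K z` gives back `X`, by the value equation; this is
substituted for `X` in `qMatrix`. -/
lemma qMatrix_eq_add_conj {K : Matrix κ ι ℝ} {X : Matrix ι ι ℝ}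
    (hX : X = policyMap A B G R K X) :
    qMatrix A B G R X = Matrix.fromBlocks G 0 0 R +
      (pairTransition A B K)ᵀ * qMatrix A B G R X * pairTransition A B K := by
  have h1 : (Matrix.fromRows (1 : Matrix ι ι ℝ) (-K))ᵀ * qMatrix A B G R X *
      Matrix.fromRows (1 : Matrix ι ι ℝ) (-K) = X := by
    have h2 : (Matrix.fromRows (1 : Matrix ι ι ℝ) (-K))ᵀ * Matrix.fromBlocks G 0 0 R *
        Matrix.fromRows (1 : Matrix ι ι ℝ) (-K) = G + Kᵀ * R * K := by
      rw [Matrix.transpose_fromRows, Matrix.fromCols_mul_fromBlocks, Matrix.fromCols_mul_fromRows]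
      simp
    have h3 : (Matrix.fromRows (1 : Matrix ι ι ℝ) (-K))ᵀ *
        ((Matrix.fromCols A B)ᵀ * X * Matrix.fromCols A B) *
        Matrix.fromRows (1 : Matrix ι ι ℝ) (-K) = (A - B * K)ᵀ * X * (A - B * K) := by
      rw [← fromCols_mul_fromRows_feedback K, Matrix.transpose_mul]
      simp only [Matrix.mul_assoc]
    rw [qMatrix, Matrix.mul_add, Matrix.add_mul, h2, h3]
    exact hX.symm
  conv_lhs => rw [qMatrix, ← h1]
  rw [pairTransition, Matrix.transpose_mul]
  simp only [Matrix.mul_assoc]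

/-- The map `(z, u) ↦ (C z, u)`. -/
def outputMatrix {ο : Type} (C : Matrix ο ι ℝ) : Matrix (ο ⊕ κ) (ι ⊕ κ) ℝ :=
  Matrix.fromBlocks C 0 0 1

lemma outputMatrix_conj {ο : Type} [Fintype ο] (C : Matrix ο ι ℝ) (Q : Matrix ο ο ℝ)
    (R : Matrix κ κ ℝ) : (outputMatrix (κ := κ) C)ᵀ * Matrix.fromBlocks Q 0 0 R *
      outputMatrix (κ := κ) C =
      Matrix.fromBlocks (Cᵀ * Q * C) 0 0 R := by
  simp [outputMatrix, Matrix.fromBlocks_transpose, Matrix.fromBlocks_multiply]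

end Bellman

/-! ### From data to the Bellman equation of the nonminimal realization -/

section Data

variable {n m p ℓ η ν : ℕ} {f : Vec n → Vec m → Vec n} {h : Vec n → Vec p} {Ψ : Vec n → Vec η}
  {A : Matrix (Fin η) (Fin η) ℝ} {B : Matrix (Fin η) (Fin m) ℝ} {C : Matrix (Fin p) (Fin η) ℝ}
  {Γ : Matrix (Fin η) (Fin ℓ × Fin p) ℝ} {T : Matrix (Fin η) (ZIdx m ℓ η) ℝ}
  {Q : Matrix (Fin p) (Fin p) ℝ} {R : Matrix (Fin m) (Fin m) ℝ}
  {ud : Fin ν → ℕ → Vec m} {yd : Fin ν → ℕ → Vec p}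
  {Ab : Matrix (ZIdx m ℓ η) (ZIdx m ℓ η) ℝ} {Bb : Matrix (ZIdx m ℓ η) (Fin m) ℝ}
  {Cb : Matrix (Fin p) (ZIdx m ℓ η) ℝ}

/-- Data of the nonlinear system are data of the linear embedding. -/
lemma IsDataTrajectory.exists_linear (hK : IsKLE f h Ψ A B C) {u : ℕ → Vec m} {y : ℕ → Vec p}
    (hd : IsDataTrajectory f h ℓ u y) :
    ∃ (ξ : ℕ → Vec η) (y' : ℕ → Vec p), IsLinTrajectory A B C ξ u y' ∧ ∀ t ≤ ℓ, y' t = y t := by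
  obtain ⟨x, hx, hy⟩ := hd
  refine ⟨_, _, linState_isLinTrajectory (Ψ (x 0)) u, fun t ht => ?_⟩
  rw [linState_eq (ξ := fun t => Ψ (x t)) (u := u) (N := ℓ)
    (fun t ht => by simp only [hx t ht, hK.2.1]) (fun _ _ => rfl) ht, hy t ht, hK.2.2]

/-- The finite data are prolonged to an infinite linear trajectory with the same input; its outputs
agree up to time `ℓ`, which is all that the two windows and `y ℓ` involve. -/
lemma IsDataTrajectory.realization (hK : IsKLE f h Ψ A B C)
    (hr : IsZRealization A B C Γ Ab Bb Cb) {u : ℕ → Vec m} {y : ℕ → Vec p}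
    (hd : IsDataTrajectory f h ℓ u y) :
    zState Γ u y 1 = Ab *ᵥ zState Γ u y 0 + Bb *ᵥ u ℓ ∧ y ℓ = Cb *ᵥ zState Γ u y 0 := by
  obtain ⟨ξ, y', hξ, hy⟩ := hd.exists_linear hK
  have h0 : zState Γ u y' 0 = zState Γ u y 0 :=
    zState_congr (fun _ _ => rfl) fun i hi => hy _ (by omega)
  have h1 : zState Γ u y' 1 = zState Γ u y 1 :=
    zState_congr (fun _ _ => rfl) fun i hi => hy _ (by omega)
  have h2 := hr ξ u y' hξ 0
  simpa only [zero_add, h0, h1, hy ℓ le_rfl] using h2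

/-- The data-driven choice of `Γ` makes the nonminimal state take all values. -/
lemma IsGammaFromData.surjective_zMap (hK : IsKLE f h Ψ A B C)
    (hd : ∀ j, IsDataTrajectory f h ℓ (ud j) (yd j)) (hΓ : IsGammaFromData (m := m) ud yd Γ) :
    Function.Surjective (zMap A B C Γ 0 : (Vec η × (ℕ → Vec m)) →ₗ[ℝ] _) := by
  obtain ⟨r, e, Pm, M, N, G, -, hUY, hM, -, hPm⟩ := hΓ
  have hsub : (Matrix.fromRows M N).submatrix
      (Equiv.sumAssoc (Fin ℓ × Fin m) (Fin η) (Fin r)).symm id =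
      Matrix.fromRows (M.submatrix Sum.inl id) (Matrix.fromRows (M.submatrix Sum.inr id) N) := by
    ext i j
    rcases i with i | i | i <;> rfl
  rw [hsub, Matrix.fromBlocks_mul_fromRows, Matrix.one_mul, Matrix.zero_mul, Matrix.zero_mul,
    add_zero, zero_add, Matrix.fromRows_ext_iff] at hUY
  obtain ⟨hU, hY⟩ := hUY
  have hY' : Matrix.fromRows (Γ * windowMatrix yd ℓ) (G * windowMatrix yd ℓ) =
      Matrix.fromRows (M.submatrix Sum.inr id) N := by
    rw [← Matrix.fromRows_mul, hY, ← Matrix.mul_assoc, hPm, Matrix.one_mul]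
  have hY'' := (Matrix.fromRows_ext_iff _ _ _ _).1 hY' |>.1
  -- Undoing the permutation identifies `M` with the matrix of the observed `z`, so its full row
  -- rank says that these span.
  have hcol : ∀ j, M.col j = zState Γ (ud j) (yd j) 0 := fun j => by
    ext i
    rcases i with i | i
    · exact (congrFun (congrFun hU i) j).symm
    · exact (congrFun (congrFun hY'' i) j).symm
  have hmem : ∀ j, M.col j ∈ LinearMap.range
      (zMap A B C Γ 0 : (Vec η × (ℕ → Vec m)) →ₗ[ℝ] _) := fun j => by
    obtain ⟨ξ, y', hξ, hy⟩ := (hd j).exists_linear hK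
    refine ⟨_, (hξ.zState_eq_zMap 0 0).symm.trans ?_⟩
    rw [hcol]
    exact zState_congr (fun _ _ => rfl) fun i hi => hy _ (by omega)
  intro z
  obtain ⟨c, rfl⟩ := exists_mulVec_eq_of_rank (M := M) (by simpa [mul_comm ℓ m] using hM) z
  rw [Matrix.mulVec_eq_sum, ← LinearMap.mem_range]
  refine Submodule.sum_mem _ fun j _ => ?_
  rw [op_smul_eq_smul]
  exact Submodule.smul_mem _ _ (hmem j)

variable {k : ThIdx m ℓ η → Fin ν}

lemma Smat_eq (hK : IsKLE f h Ψ A B C) (hr : IsZRealization A B C Γ Ab Bb Cb)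
    (hd : ∀ j, IsDataTrajectory f h ℓ (ud j) (yd j)) (K : Matrix (Fin m) (ZIdx m ℓ η) ℝ) :
    Smat Γ ud yd k K = pairTransition Ab Bb K * Zmat Γ ud yd k := by
  have hz : ∀ j, zState Γ (ud (k j)) (yd (k j)) 1 =
      Matrix.fromCols Ab Bb *ᵥ (Zmat Γ ud yd k).col j := fun j => by
    rw [((hd (k j)).realization hK hr).1]
    exact (Matrix.fromCols_mulVec_sumElim _ _ _ _).symm
  ext i j
  rw [pairTransition, Matrix.mul_assoc]
  change Sum.elim (zState Γ (ud (k j)) (yd (k j)) 1)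
    (-(K *ᵥ zState Γ (ud (k j)) (yd (k j)) 1)) i =
      (Matrix.fromRows 1 (-K) *ᵥ (Matrix.fromCols Ab Bb *ᵥ (Zmat Γ ud yd k).col j)) i
  rw [← hz, Matrix.fromRows_mulVec, Matrix.one_mulVec, Matrix.neg_mulVec]

lemma Wmat_eq (hK : IsKLE f h Ψ A B C) (hr : IsZRealization A B C Γ Ab Bb Cb)
    (hd : ∀ j, IsDataTrajectory f h ℓ (ud j) (yd j)) :
    Wmat ud yd k = outputMatrix (κ := Fin m) Cb * Zmat Γ ud yd k := by
  ext i j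
  change Sum.elim (yd (k j) ℓ) (ud (k j) ℓ) i = ((Matrix.fromBlocks Cb 0 0 1 : Matrix (Fin p ⊕ Fin m) (ThIdx m ℓ η) ℝ) *ᵥ
    Sum.elim (zState Γ (ud (k j)) (yd (k j)) 0) (ud (k j) ℓ)) i
  rw [Matrix.fromBlocks_mulVec, ((hd (k j)).realization hK hr).2]
  simp

/-- With a nonsingular data matrix, the data-based Bellman equation is a Stein equation. -/
lemma bellman_iff (hK : IsKLE f h Ψ A B C) (hr : IsZRealization A B C Γ Ab Bb Cb)
    (hd : ∀ j, IsDataTrajectory f h ℓ (ud j) (yd j)) (hZ : IsUnit (Zmat Γ ud yd k).det)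
    (K : Matrix (Fin m) (ZIdx m ℓ η) ℝ) (Θ : Matrix (ThIdx m ℓ η) (ThIdx m ℓ η) ℝ) :
    Bellman Q R Γ ud yd k K Θ ↔ Θ = Matrix.fromBlocks (Cbᵀ * Q * Cb) 0 0 R +
      (pairTransition Ab Bb K)ᵀ * Θ * pairTransition Ab Bb K := by
  set Z := Zmat Γ ud yd k with hZdef
  have hcancel : ∀ X Y : Matrix (ThIdx m ℓ η) (ThIdx m ℓ η) ℝ, Zᵀ * X * Z = Zᵀ * Y * Z ↔ X = Y :=
    fun X Y => by
      refine ⟨fun hXY => ?_, fun hXY => by rw [hXY]⟩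
      have h1 := congrArg (fun M => (Zᵀ)⁻¹ * (M * Z⁻¹)) hXY
      have hZt : IsUnit (Zᵀ).det := by rwa [Matrix.det_transpose]
      simpa only [Matrix.mul_nonsing_inv_cancel_right _ _ hZ,
        Matrix.nonsing_inv_mul_cancel_left _ _ hZt] using h1
  rw [← hcancel, Bellman, Smat_eq hK hr hd, Wmat_eq hK hr hd, ← outputMatrix_conj, ← hZdef]
  simp only [Matrix.transpose_mul, Matrix.mul_add, Matrix.add_mul, Matrix.mul_assoc]

/-- A feedback that stabilizes the nonminimal realization stabilizes the nonlinear system. -/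
lemma stabilizes_of_powTendsto (hK : IsKLE f h Ψ A B C) (hdet : Detectable f h)
    (hr : IsZRealization A B C Γ Ab Bb Cb) {K : Matrix (Fin m) (ZIdx m ℓ η) ℝ}
    (hF : PowTendsto (Ab - Bb * K)) : Stabilizes f h Γ K := by
  intro x u y hc
  have hξ := hK.isLinTrajectory hc.1
  have hz : Tendsto (fun s => zState Γ u y s) atTop (𝓝 0) := by
    refine hF.tendsto_iterate fun s => ?_
    rw [(hr _ u y hξ s).1, hc.2, Matrix.sub_mulVec, Matrix.mulVec_neg, ← Matrix.mulVec_mulVec,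
      sub_eq_add_neg]
  refine hdet x u y hc.1 ((tendsto_add_atTop_iff_nat ℓ).1 ?_)
  simp only [fun s => (hr _ u y hξ s).2]
  have hcC : Continuous fun v : ZIdx m ℓ η → ℝ => Cb *ᵥ v := by fun_prop
  simpa [Function.comp_def] using (hcC.tendsto 0).comp hz

/-- The optimal value matrix of the minimal system solves the Riccati equation of the nonminimal
realization, and the optimal gains correspond. -/
lemma riccati_of_intertwines {P : Matrix (Fin η) (Fin η) ℝ} (hTA : T * Ab = A * T)
    (hTB : T * Bb = B) (hTC : Cb = C * T)
    (hPe : P = policyMap A B (Cᵀ * Q * C) R (greedyGain A B R P) P) :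
    greedyGain Ab Bb R (Tᵀ * P * T) = greedyGain A B R P * T ∧
      Tᵀ * P * T = policyMap Ab Bb (Cbᵀ * Q * Cb) R (greedyGain Ab Bb R (Tᵀ * P * T))
        (Tᵀ * P * T) := by
  have hg : greedyGain Ab Bb R (Tᵀ * P * T) = greedyGain A B R P * T := by
    have h1 : Bbᵀ * (Tᵀ * P * T) * Bb = Bᵀ * P * B := by
      rw [← hTB, Matrix.transpose_mul]; simp only [Matrix.mul_assoc]
    rw [greedyGain, greedyGain, h1]
    have h2 : Bbᵀ * (Tᵀ * (P * (T * Ab))) = Bᵀ * (P * (A * T)) := by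
      rw [hTA, ← hTB, Matrix.transpose_mul]; simp only [Matrix.mul_assoc]
    simp only [Matrix.mul_assoc, h2]
  refine ⟨hg, ?_⟩
  rw [hg]
  set K := greedyGain A B R P
  have h3 : T * (Ab - Bb * (K * T)) = (A - B * K) * T := by
    rw [Matrix.mul_sub, ← Matrix.mul_assoc, ← Matrix.mul_assoc, hTA, hTB, Matrix.sub_mul,
      Matrix.mul_assoc B]
  have h4 : (Ab - Bb * (K * T))ᵀ * (Tᵀ * P * T) * (Ab - Bb * (K * T)) =
      Tᵀ * ((A - B * K)ᵀ * P * (A - B * K)) * T := by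
    calc _ = (T * (Ab - Bb * (K * T)))ᵀ * P * (T * (Ab - Bb * (K * T))) := by
          rw [Matrix.transpose_mul]; simp only [Matrix.mul_assoc]
      _ = _ := by rw [h3, Matrix.transpose_mul]; simp only [Matrix.mul_assoc]
  rw [policyMap, h4, hTC]
  conv_lhs => rw [hPe]
  simp only [policyMap, Matrix.transpose_mul, Matrix.mul_add, Matrix.add_mul, Matrix.mul_assoc]

end Data

end KoopmanQL

/-! ### The main theorem -/

theorem theorem2 {n m p : ℕ} (f : Vec n → Vec m → Vec n) (h : Vec n → Vec p)
    (hf : Continuous fun q : Vec n × Vec m => f q.1 q.2) (hh : Continuous h)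
    (hf0 : f 0 0 = 0) (hh0 : h 0 = 0)
    (hKLE : AdmitsKLE f h) (hstab : Stabilizable f) (hdet : Detectable f h)
    (Q : Matrix (Fin p) (Fin p) ℝ) (R : Matrix (Fin m) (Fin m) ℝ)
    (hQ : Q.PosDef) (hR : R.PosDef) :
    -- an observable embedding exists
    (∃ (η : ℕ) (Ψ : Vec n → Vec η) (A : Matrix (Fin η) (Fin η) ℝ) (B : Matrix (Fin η) (Fin m) ℝ)
      (C : Matrix (Fin p) (Fin η) ℝ), IsKLE f h Ψ A B C ∧ Observable A C) ∧
    -- for every observable embedding with lag `ℓ`, and all `Γ`, `T` with `ξ = T z`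
    ∀ (η : ℕ) (Ψ : Vec n → Vec η) (A : Matrix (Fin η) (Fin η) ℝ) (B : Matrix (Fin η) (Fin m) ℝ)
      (C : Matrix (Fin p) (Fin η) ℝ), IsKLE f h Ψ A B C → Observable A C →
    ∀ ℓ : ℕ, IsLag A C ℓ →
    ∀ (Γ : Matrix (Fin η) (Fin ℓ × Fin p) ℝ) (T : Matrix (Fin η) (ZIdx m ℓ η) ℝ),
      IsStateMap A B C Γ T →
    ∃ P : Matrix (Fin η) (Fin η) ℝ,
      IsRiccatiSolution A B C Q R P ∧ (∀ P', IsRiccatiSolution A B C Q R P' → P' = P) ∧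
      -- the feedback `u = -K* T z` stabilizes the nonlinear system and minimizes the cost
      Stabilizes f h Γ (lqrGain A B R P * T) ∧
      MinimizesCost f h Q R Γ (lqrGain A B R P * T) ∧
      -- the learning algorithm, for all admissible data
      ∀ (ν : ℕ) (ud : Fin ν → ℕ → Vec m) (yd : Fin ν → ℕ → Vec p),
        (∀ j, IsDataTrajectory f h ℓ (ud j) (yd j)) → PersistentlyExcited ℓ η ud yd →
        IsGammaFromData ud yd Γ →
        (∃ Ab Bb Cb, IsZRealization A B C Γ Ab Bb Cb) ∧
        ∀ Ab Bb Cb, IsZRealization A B C Γ Ab Bb Cb →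
        ∀ k : ThIdx m ℓ η → Fin ν, IsUnit (Zmat Γ ud yd k).det →
        ∀ K₀ : Matrix (Fin m) (ZIdx m ℓ η) ℝ, IsSchur (Ab - Bb * K₀) →
        ∃ (K : ℕ → Matrix (Fin m) (ZIdx m ℓ η) ℝ)
          (Θ : ℕ → Matrix (ThIdx m ℓ η) (ThIdx m ℓ η) ℝ),
          K 0 = K₀ ∧
          (∀ i,
            -- `Θ^{i+1}` is the unique solution of the Bellman equation of `K^i`
            Bellman Q R Γ ud yd k (K i) (Θ (i + 1)) ∧
            (∀ Θ', Bellman Q R Γ ud yd k (K i) Θ' → Θ' = Θ (i + 1)) ∧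
            -- the update `K^{i+1} = (Θ_uu^{i+1})⁻¹ Θ_uz^{i+1}` is well defined
            (Θ (i + 1)).IsSymm ∧ IsUnit (Θ (i + 1)).toBlocks₂₂.det ∧
            K (i + 1) = (Θ (i + 1)).toBlocks₂₂⁻¹ * (Θ (i + 1)).toBlocks₂₁ ∧
            -- `K^i` is stabilizing
            IsSchur (Ab - Bb * K i) ∧ Stabilizes f h Γ (K i)) ∧
          ConvergesQuadratically K (lqrGain A B R P * T) := by
  refine ⟨hKLE.exists_observable, fun η Ψ A B C hK hO ℓ _ Γ T hT => ?_⟩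
  have hn : nullControllable A B = ⊤ :=
    hK.nullControllable_eq_top (hK.continuous hO hf hh) (hK.map_zero hO hf0 hh0) hstab
  obtain ⟨P, hP, hPu⟩ := exists_unique_riccati hn hO hT hQ hR
  refine ⟨P, hP, hPu, stabilizes_lqrGain hK hdet hT hQ hR hP, minimizesCost_lqrGain hK hT hQ hR hP,
    fun ν ud yd hd _ hΓ => ?_⟩
  have hs := hΓ.surjective_zMap hK hd
  refine ⟨exists_isZRealization hs hT, fun Ab Bb Cb hr k hZ K₀ hK₀ => ?_⟩
  obtain ⟨hTA, hTB, hTC⟩ := hT.intertwines hr hs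
  obtain ⟨hPd, hPe⟩ := (isRiccatiSolution_iff hR).1 hP
  obtain ⟨hgain, hXe⟩ := riccati_of_intertwines hTA hTB hTC hPe
  have hG := posSemidef_conj hQ.posSemidef Cb
  obtain ⟨K, X, hK0, hiter, hconv⟩ := (hr.stageDetectable hs hQ hR).policy_iteration hG hR
    (posSemidef_conj hPd.posSemidef T) hXe hK₀.powTendsto
  have hconv' : ConvergesQuadratically K (lqrGain A B R P * T) := by
    rw [hgain] at hconv
    exact hconv
  -- `Θ (i + 1)` belongs to the value `X i` of `K i`, whence the shift; the entry at `0` is a dummy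
  -- value.
  refine ⟨K, fun i => qMatrix Ab Bb (Cbᵀ * Q * Cb) R (X (i - 1)), hK0, fun i => ?_, hconv'⟩
  obtain ⟨hF, hXp, hXi, hKs⟩ := hiter i
  have hb := bellman_iff (Q := Q) (R := R) hK hr hd hZ (K i)
  have hΘ := qMatrix_eq_add_conj hXi
  beta_reduce
  rw [Nat.add_sub_cancel]
  refine ⟨(hb _).2 hΘ, fun Θ' hΘ' => hF.pairTransition.stein_unique ((hb _).1 hΘ') hΘ,
    qMatrix_isSymm hG.isSymm hR.posSemidef.isSymm hXp.isSymm, ?_, ?_, hF.isSchur,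
    stabilizes_of_powTendsto hK hdet hr hF⟩
  · rw [qMatrix_eq, Matrix.toBlocks_fromBlocks₂₂]
    exact inputWeight_isUnit_det hR hXp
  · rw [hKs, qMatrix_eq, Matrix.toBlocks_fromBlocks₂₂, Matrix.toBlocks_fromBlocks₂₁, greedyGain]
    simp only [Matrix.mul_assoc]
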